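/- Work with based CW complexes (the base point being a vertex); $\simeq$ denotes based homotopy equivalence, $\Sigma$ the reduced suspension, and products are formed with the compactly generated topology, so that a product of finitely many CW complexes is a CW complex. Let $X_1\vee\dots\vee X_k$ be the wedge (the disjoint union with base points identified) and let $X_1\wedge\dots\wedge X_k$ be the smash product (the product modulo the subspace of points having at least one coordinate equal to the base point). For an integer $n\ge 0$, a CW complex $X$ is called an $S^nS$-space if there is a CW complex $Y$ such that $\Sigma^nX\simeq\Sigma^{n+1}Y$. **Lemma.** Let $n\ge 0$, $k\ge 1$, and let $X_1,\dots,X_k$ be $S^nS$-spaces. Then 1. $X_1\vee\dots\vee X_k$ is an $S^nS$-space; 2. $X_1\wedge\dots\wedge X_k$ is an $S^nS$-space; 3. if $n\ge 1$, then $X_1\times\dots\times X_k$ is an $S^nS$-space. -/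

import Mathlib

open Topology

universe u

noncomputable section

/-- A topological space with a chosen base point. -/
structure PtdSpace : Type (u + 1) where
  /-- the underlying set -/
  carrier : Type u
  /-- the topology -/
  [top : TopologicalSpace carrier]
  /-- the base point -/
  pt : carrier

namespace PtdSpace

instance : CoeSort PtdSpace.{u} (Type u) := ⟨PtdSpace.carrier⟩

instance (X : PtdSpace.{u}) : TopologicalSpace X := X.top

/-- Two based spaces are based homotopy equivalent: there are based maps `f : X → Y` and
`g : Y → X` whose two composites are homotopic to the identity relative to the base point. -/
def HtpyEquiv (X Y : PtdSpace.{u}) : Prop :=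
  ∃ (f : C(X, Y)) (g : C(Y, X)), f X.pt = Y.pt ∧ g Y.pt = X.pt ∧
    (g.comp f).HomotopicRel (ContinuousMap.id X) {X.pt} ∧
    (f.comp g).HomotopicRel (ContinuousMap.id Y) {Y.pt}

/-- The based space `X` is a based CW complex: it is Hausdorff and it admits a CW structure
in which the base point is a vertex (a `0`-cell). -/
def IsCW (X : PtdSpace.{u}) : Prop :=
  T2Space X ∧ ∃ (C : CWComplex (Set.univ : Set X)) (i : C.cell 0), C.map 0 i ![] = X.pt

/-- The equivalence relation on `Z` that identifies all the points of `A` with each other,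
and nothing else. -/
def collapseSetoid {Z : Type u} (A : Set Z) : Setoid Z where
  r p q := p = q ∨ (p ∈ A ∧ q ∈ A)
  iseqv :=
    { refl := fun _ => Or.inl rfl
      symm := by
        rintro p q (rfl | ⟨hp, hq⟩)
        · exact Or.inl rfl
        · exact Or.inr ⟨hq, hp⟩
      trans := by
        rintro p q r (rfl | ⟨hp, hq⟩) (rfl | ⟨hq', hr⟩)
        · exact Or.inl rfl
        · exact Or.inr ⟨hq', hr⟩
        · exact Or.inr ⟨hp, hq⟩
        · exact Or.inr ⟨hp, hr⟩ }

/-- The quotient space `Z / A`, with the quotient topology, based at the class of `a`.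
It is used only for `a ∈ A`, so that the base point is the point to which `A` is collapsed. -/
def collapse (Z : Type u) [TopologicalSpace Z] (A : Set Z) (a : Z) : PtdSpace.{u} where
  carrier := Quotient (collapseSetoid A)
  pt := Quotient.mk (collapseSetoid A) a

/-- The reduced suspension `ΣX = (X × [0,1]) / (X × {0} ∪ X × {1} ∪ {*} × [0,1])`. -/
def susp (X : PtdSpace.{u}) : PtdSpace.{u} :=
  collapse (X × unitInterval) {p | p.2 = 0 ∨ p.2 = 1 ∨ p.1 = X.pt} (X.pt, 0)

/-- The wedge of a nonempty family of based spaces: the disjoint union with all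
the base points identified. -/
def wedge {ι : Type} [Nonempty ι] (X : ι → PtdSpace.{u}) : PtdSpace.{u} :=
  collapse (Σ i, X i) {p | p.2 = (X p.1).pt}
    ⟨Classical.arbitrary ι, (X (Classical.arbitrary ι)).pt⟩

open scoped CompactCoherentification in
/-- The product of a family of based spaces, with the compactly generated (k-ified) product
topology. For finitely many CW complexes this is the topology of the product CW complex,
whose cells are the products of cells of the factors. -/
def prod {ι : Type} (X : ι → PtdSpace.{u}) : PtdSpace.{u} where
  carrier := 𝐤 (∀ i, X i)
  pt := CompactCoherentification.mk _ (fun i => (X i).pt)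

open scoped CompactCoherentification in
/-- The smash product of a nonempty family of based spaces: the quotient of the
(compactly generated) product by the fat wedge, that is, by the set of all points at least one
coordinate of which is a base point. -/
def smash {ι : Type} (X : ι → PtdSpace.{u}) : PtdSpace.{u} :=
  collapse (𝐤 (∀ i, X i))
    {p | ∃ i, (CompactCoherentification.mk (∀ i, X i)).symm p i = (X i).pt}
    (CompactCoherentification.mk _ (fun i => (X i).pt))

/-- `X` is an `SⁿS`-space: `X` is a CW complex and there is a CW complex `Y` with
`Σⁿ X ≃ Σⁿ⁺¹ Y`. -/
def IsSnS (n : ℕ) (X : PtdSpace.{u}) : Prop :=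
  X.IsCW ∧ ∃ Y : PtdSpace.{u}, Y.IsCW ∧ HtpyEquiv (susp^[n] X) (susp^[n + 1] Y)

end PtdSpace

end

/-! Wedges: reduced suspension commutes with wedges, so if `Σⁿ Xᵢ ≃ Σⁿ⁺¹ Yᵢ`, the wedge of the `Yᵢ`
desuspends the wedge of the `Xᵢ` (`IsSnS.wedge`).

Smash products: regard the smash as `X₀` smashed with a pair `(Z, B)`, where `Z` is the product of
the other factors and `B` its fat wedge. Suspension passes into the first factor (`susp_smashWith`),
so `Σⁿ(X₀ ∧ Z/B) ≃ (Σⁿ X₀) ∧ Z/B ≃ (Σⁿ⁺¹ Y₀) ∧ Z/B ≃ Σⁿ⁺¹(Y₀ ∧ Z/B)`. One `SⁿS` factor suffices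
(`IsSnS.smashOn`), and the argument works for any set of coordinates containing `0`, in particular
for the half-smash `X₀ × Z / * × Z`.

Products: `A = * × Z` is a retract of `B = X₀ × Z`, and after one suspension `ΣB ≃ ΣA ∨ Σ(B/A)`
(`FibrewiseRetract.htpyEquiv`, `susp_prod`). Here `B/A` is the half-smash and `A` is a shorter
product, so induction on the number of factors reduces to wedges and smashes. The splitting costs
one suspension, which is why `n ≥ 1` is needed. Its inverse uses the difference "identity minus `i ∘
r`" of loops in `ΣB`, modified near `A` so as to be constant on `A`. All homotopies are explicit,
hence no connectivity is needed; the deformation near `A` comes from the well-pointedness of the CW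
complex `X₀`.

The point-set input is that wedges, compactly generated products and their quotients by subcomplexes
are CW complexes, and that compactly generated products preserve quotient maps. Iterated suspensions
only have to be compactly generated; their cell structures never enter. -/

section

open Set Metric Function
open scoped unitInterval CompactCoherentification Set.Notation

/-! ### Cell structures with cubical cells, and induction over the cells -/

/-- A cell structure on a space `X`: the characteristic maps of the cells, whose domains are the
unit cubes in `J i → ℝ` for finite types `J i`, subject to the conditions for a CW complex. -/
structure CellStructure (X : Type u) [TopologicalSpace X] where
  /-- the cells -/
  ι : Type u
  /-- the coordinates of a cell -/
  J : ι → Type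
  [fin : ∀ i, Fintype (J i)]
  /-- the characteristic maps -/
  Φ : ∀ i, (J i → ℝ) → X
  cont : ∀ i, ContinuousOn (Φ i) (closedBall 0 1)
  injOn : ∀ i, InjOn (Φ i) (ball 0 1)
  disj : ∀ i j, ∀ x ∈ ball (0 : J i → ℝ) 1, ∀ y ∈ ball (0 : J j → ℝ) 1, Φ i x = Φ j y → i = j
  frontier : ∀ i, ∃ F : Set ι, F.Finite ∧ (∀ j ∈ F, Fintype.card (J j) < Fintype.card (J i)) ∧
    ∀ x ∈ sphere (0 : J i → ℝ) 1, ∃ j ∈ F, Φ i x ∈ Φ j '' closedBall 0 1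
  closed : ∀ A : Set X, (∀ i, IsClosed (A ∩ Φ i '' closedBall 0 1)) → IsClosed A
  cover : ∀ x, ∃ i, ∃ b ∈ ball (0 : J i → ℝ) 1, Φ i b = x

namespace CellStructure

variable {X : Type u} [TopologicalSpace X] (C : CellStructure X)

instance (i : C.ι) : Fintype (C.J i) := C.fin i

/-- The dimension of a cell. -/
def dim (i : C.ι) : ℕ := Fintype.card (C.J i)

/-- The cell whose interior contains a given point. -/
noncomputable def idx (x : X) : C.ι := (C.cover x).choose

/-- The coordinates of a point in the cell whose interior contains it. -/
noncomputable def coord (x : X) : C.J (C.idx x) → ℝ := (C.cover x).choose_spec.choose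

lemma coord_mem (x : X) : C.coord x ∈ ball (0 : C.J (C.idx x) → ℝ) 1 :=
  (C.cover x).choose_spec.choose_spec.1

lemma map_coord (x : X) : C.Φ (C.idx x) (C.coord x) = x :=
  (C.cover x).choose_spec.choose_spec.2

lemma idx_map {i : C.ι} {b : C.J i → ℝ} (hb : b ∈ ball 0 1) : C.idx (C.Φ i b) = i :=
  C.disj _ _ _ (C.coord_mem _) _ hb (C.map_coord _)

/-- Induction on the dimension: the boundary point lies in a closed cell of smaller dimension,
either in its interior, which settles the matter, or again on its boundary. -/
lemma dim_idx_map_lt {i : C.ι} {b : C.J i → ℝ} (hb : b ∈ sphere 0 1) :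
    C.dim (C.idx (C.Φ i b)) < C.dim i := by
  induction hn : C.dim i using Nat.strong_induction_on generalizing i with
  | _ n ih =>
    obtain ⟨F, -, hF, hs⟩ := C.frontier i
    obtain ⟨j, hj, c, hc, hcb⟩ := hs b hb
    have hlt : C.dim j < n := hn ▸ hF j hj
    rw [← hcb]
    rcases (mem_closedBall.1 hc).lt_or_eq with h | h
    · rw [C.idx_map (mem_ball.2 h)]
      exact hlt
    · exact (ih _ hlt (mem_sphere.2 h) rfl).trans hlt

lemma ball_of_idx_map {i : C.ι} {b : C.J i → ℝ} (hb : b ∈ closedBall 0 1)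
    (h : C.idx (C.Φ i b) = i) : b ∈ ball 0 1 := by
  rcases (mem_closedBall.1 hb).lt_or_eq with h' | h'
  · exact h'
  · exact absurd (C.dim_idx_map_lt (mem_sphere.2 h')) (by rw [h]; exact lt_irrefl _)

lemma isCompact_cell (i : C.ι) : IsCompact (C.Φ i '' closedBall 0 1) :=
  (isCompact_closedBall _ _).image_of_continuousOn (C.cont i)

lemma mem_cell (x : X) : x ∈ C.Φ (C.idx x) '' closedBall 0 1 :=
  ⟨_, ball_subset_closedBall (C.coord_mem x), C.map_coord x⟩

section T2

variable [T2Space X]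

/-- Closed cells are compact images in a Hausdorff space, so closedness may be tested on the domains
of the characteristic maps. -/
lemma isClosed_of_preimage {A : Set X}
    (h : ∀ i, IsClosed (closedBall 0 1 ∩ C.Φ i ⁻¹' A)) : IsClosed A := by
  refine C.closed A fun i => ?_
  have : A ∩ C.Φ i '' closedBall 0 1 = C.Φ i '' (closedBall 0 1 ∩ C.Φ i ⁻¹' A) := by
    rw [image_inter_preimage, inter_comm]
  rw [this]
  exact ((((isCompact_closedBall _ _).of_isClosed_subset (h i) inter_subset_left)).image_of_continuousOn
    ((C.cont i).mono inter_subset_left)).isClosed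

lemma continuous_of_cells {T : Type*} [TopologicalSpace T] {f : X → T}
    (h : ∀ i, ContinuousOn (f ∘ C.Φ i) (closedBall 0 1)) : Continuous f := by
  refine continuous_iff_isClosed.2 fun A hA => C.isClosed_of_preimage fun i => ?_
  exact (h i).preimage_isClosed_of_isClosed isClosed_closedBall hA

/-- On each lower closed cell `g` is continuous because the characteristic map is closed onto it.
Closure finiteness then allows gluing over a finite closed cover of the boundary. -/
lemma continuousOn_sphere {T : Type*} [TopologicalSpace T] {g : X → T} {i : C.ι}
    (h : ∀ j, C.dim j < C.dim i → ContinuousOn (g ∘ C.Φ j) (closedBall 0 1)) :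
    ContinuousOn (g ∘ C.Φ i) (sphere 0 1) := by
  obtain ⟨F, hfin, hF, hs⟩ := C.frontier i
  have key : ContinuousOn g (⋃ j ∈ F, C.Φ j '' closedBall 0 1) := by
    have hj : ∀ j ∈ F, ContinuousOn g (C.Φ j '' closedBall 0 1) := by
      intro j hj
      rw [continuousOn_iff_isClosed]
      intro t ht
      refine ⟨C.Φ j '' (closedBall 0 1 ∩ (g ∘ C.Φ j) ⁻¹' t), ?_, ?_⟩
      · have hc := (h j (hF j hj)).preimage_isClosed_of_isClosed isClosed_closedBall ht
        exact (((isCompact_closedBall _ _).of_isClosed_subset hc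
          inter_subset_left).image_of_continuousOn
          ((C.cont j).mono inter_subset_left)).isClosed
      · ext x
        constructor
        · rintro ⟨hx, b, hb, rfl⟩
          exact ⟨⟨b, ⟨hb, hx⟩, rfl⟩, b, hb, rfl⟩
        · rintro ⟨⟨b, ⟨hb, hx⟩, rfl⟩, -⟩
          exact ⟨hx, b, hb, rfl⟩
    have := hfin.to_subtype
    rw [biUnion_eq_iUnion]
    exact (locallyFinite_of_finite _).continuousOn_iUnion
      (fun j => (C.isCompact_cell j.1).isClosed) fun j => hj j.1 j.2
  refine key.comp ((C.cont i).mono sphere_subset_closedBall) fun x hx => ?_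
  obtain ⟨j, hj, hx⟩ := hs x hx
  exact mem_biUnion hj hx

/-- Construction of continuous maps out of a cell complex by induction over its cells. -/
theorem exists_continuous_of_cells {T : Type*} [TopologicalSpace T] [Nonempty T]
    (P : ∀ i, ((C.J i → ℝ) → T) → Prop)
    (hP : ∀ i h h', EqOn h h' (closedBall 0 1) → P i h → P i h')
    (H : ∀ i (g : X → T),
      (∀ j, C.dim j < C.dim i → ContinuousOn (g ∘ C.Φ j) (closedBall 0 1) ∧ P j (g ∘ C.Φ j)) →
      ContinuousOn (g ∘ C.Φ i) (sphere 0 1) →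
      ∃ h : (C.J i → ℝ) → T, ContinuousOn h (closedBall 0 1) ∧ EqOn h (g ∘ C.Φ i) (sphere 0 1) ∧
        P i h) :
    ∃ f : C(X, T), ∀ i, P i (f ∘ C.Φ i) := by
  classical
  let Good (n : ℕ) (g : X → T) : Prop :=
    ∀ j, C.dim j < n → ContinuousOn (g ∘ C.Φ j) (closedBall 0 1) ∧ P j (g ∘ C.Φ j)
  have step : ∀ n (g : X → T), Good n g →
      ∃ g', Good (n + 1) g' ∧ ∀ x, C.dim (C.idx x) < n → g' x = g x := by
    intro n g hg
    have hH : ∀ i, ∃ h : (C.J i → ℝ) → T, C.dim i = n →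
        ContinuousOn h (closedBall 0 1) ∧ EqOn h (g ∘ C.Φ i) (sphere 0 1) ∧ P i h := by
      intro i
      by_cases hi : C.dim i = n
      · subst hi
        obtain ⟨h, hh⟩ := H i g hg (C.continuousOn_sphere fun j hj => (hg j hj).1)
        exact ⟨h, fun _ => hh⟩
      · exact ⟨fun _ => Classical.arbitrary T, fun h => absurd h hi⟩
    choose h hh using hH
    -- Only the open `n`-cells are redefined; lower cells keep their values, and values on higher
    -- cells carry no information yet.
    let g' : X → T := fun x => if C.dim (C.idx x) = n then h (C.idx x) (C.coord x) else g x
    have hlow : ∀ x, C.dim (C.idx x) < n → g' x = g x := fun x hx => if_neg hx.ne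
    refine ⟨g', fun j hj => ?_, hlow⟩
    rcases (Nat.lt_succ_iff.1 hj).lt_or_eq with hj | hj
    · have heq : EqOn (g ∘ C.Φ j) (g' ∘ C.Φ j) (closedBall 0 1) := by
        intro b hb
        refine (hlow _ ?_).symm
        rcases (mem_closedBall.1 hb).lt_or_eq with h' | h'
        · rw [C.idx_map (mem_ball.2 h')]; exact hj
        · exact (C.dim_idx_map_lt (mem_sphere.2 h')).trans hj
      exact ⟨(hg j hj).1.congr heq.symm, hP _ _ _ heq (hg j hj).2⟩
    · obtain ⟨hc, hs, hPj⟩ := hh j hj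
      have heq : EqOn (h j) (g' ∘ C.Φ j) (closedBall 0 1) := by
        intro b hb
        rcases (mem_closedBall.1 hb).lt_or_eq with h' | h'
        · have hi := C.idx_map (mem_ball.2 h')
          have h1 := C.map_coord (C.Φ j b)
          have h2 := C.coord_mem (C.Φ j b)
          simp only [g', Function.comp]
          generalize C.coord (C.Φ j b) = c at *
          generalize C.idx (C.Φ j b) = k at *
          subst hi
          rw [if_pos hj, C.injOn _ h2 (mem_ball.2 h') h1]
        · have hlt := (C.dim_idx_map_lt (mem_sphere.2 h'))
          rw [hs (mem_sphere.2 h')]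
          exact (hlow _ (hj ▸ hlt)).symm
      exact ⟨hc.congr heq.symm, hP _ _ _ heq hPj⟩
  choose! s hs using step
  -- Stage `0` may be any function, since no cell has negative dimension.
  let G : ℕ → X → T := fun n => Nat.rec (fun _ => Classical.arbitrary T) (fun n g => s n g) n
  have hG : ∀ n, Good n (G n) := by
    intro n
    induction n with
    | zero => exact fun j hj => absurd hj (Nat.not_lt_zero _)
    | succ n ih => exact (hs n _ ih).1
  have hstab : ∀ x m, C.dim (C.idx x) < m → G m x = G (C.dim (C.idx x) + 1) x := by
    intro x m hm
    induction m, (Nat.succ_le_of_lt hm) using Nat.le_induction with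
    | base => rfl
    | succ m hm' ih =>
      rw [← ih (Nat.lt_of_succ_le hm')]
      exact (hs m _ (hG m)).2 x (Nat.lt_of_succ_le hm')
  -- The value at `x` is frozen at the first stage that treats the open cell of `x`; `hstab` says
  -- that later stages agree.
  let f : X → T := fun x => G (C.dim (C.idx x) + 1) x
  have hf : ∀ i, EqOn (G (C.dim i + 1) ∘ C.Φ i) (f ∘ C.Φ i) (closedBall 0 1) := by
    intro i b hb
    refine hstab (C.Φ i b) (C.dim i + 1) ?_
    rcases (mem_closedBall.1 hb).lt_or_eq with h' | h'
    · rw [C.idx_map (mem_ball.2 h')]; exact Nat.lt_succ_self _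
    · exact (C.dim_idx_map_lt (mem_sphere.2 h')).trans (Nat.lt_succ_self _)
  refine ⟨⟨f, C.continuous_of_cells fun i => ?_⟩, fun i => ?_⟩
  · exact ((hG (C.dim i + 1)) i (Nat.lt_succ_self _)).1.congr (hf i).symm
  · exact hP _ _ _ (hf i) ((hG (C.dim i + 1)) i (Nat.lt_succ_self _)).2

/-- CW complexes are normal. -/
theorem normalSpace (C : CellStructure X) : NormalSpace X := by
  refine ⟨fun A B hA hB hAB => ?_⟩
  obtain ⟨f, hf⟩ := C.exists_continuous_of_cells (T := ℝ)
    (fun i h => ∀ b ∈ closedBall (0 : C.J i → ℝ) 1,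
      (C.Φ i b ∈ A → h b = 0) ∧ (C.Φ i b ∈ B → h b = 1))
    (fun i h h' hh hp b hb => by rw [← hh hb]; exact hp b hb)
    (fun i g hg hc => by
      classical
      have hA' : IsClosed (closedBall 0 1 ∩ C.Φ i ⁻¹' A) :=
        (C.cont i).preimage_isClosed_of_isClosed isClosed_closedBall hA
      have hB' : IsClosed (closedBall 0 1 ∩ C.Φ i ⁻¹' B) :=
        (C.cont i).preimage_isClosed_of_isClosed isClosed_closedBall hB
      have hgs : ∀ b ∈ sphere (0 : C.J i → ℝ) 1,
          (C.Φ i b ∈ A → g (C.Φ i b) = 0) ∧ (C.Φ i b ∈ B → g (C.Φ i b) = 1) := by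
        intro b hb
        obtain ⟨F, -, hF, hs⟩ := C.frontier i
        obtain ⟨j, hj, c, hc, hcb⟩ := hs b hb
        rw [← hcb]
        exact (hg j (hF j hj)).2 c hc
      -- Urysohn function on one cell: the values prescribed on the boundary, on `A` and on `B`
      -- agree and live on a closed set, so Tietze extends them.
      let k : (C.J i → ℝ) → ℝ := fun b =>
        if b ∈ sphere (0 : C.J i → ℝ) 1 then g (C.Φ i b) else if C.Φ i b ∈ A then 0 else 1
      have hkA : ∀ b ∈ closedBall 0 1 ∩ C.Φ i ⁻¹' A, k b = 0 := by
        intro b hb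
        by_cases h : b ∈ sphere (0 : C.J i → ℝ) 1
        · simp only [k, if_pos h]; exact (hgs b h).1 hb.2
        · simp only [k, if_neg h]; exact if_pos hb.2
      have hkB : ∀ b ∈ closedBall 0 1 ∩ C.Φ i ⁻¹' B, k b = 1 := by
        intro b hb
        by_cases h : b ∈ sphere (0 : C.J i → ℝ) 1
        · simp only [k, if_pos h]; exact (hgs b h).2 hb.2
        · simp only [k, if_neg h]
          exact if_neg fun h' => hAB.notMem_of_mem_left h' hb.2
      have hk : ContinuousOn k (sphere 0 1 ∪
          (closedBall 0 1 ∩ C.Φ i ⁻¹' A ∪ closedBall 0 1 ∩ C.Φ i ⁻¹' B)) := by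
        refine ContinuousOn.union_of_isClosed (hc.congr fun b hb => if_pos hb)
          (ContinuousOn.union_of_isClosed (continuousOn_const.congr hkA)
            (continuousOn_const.congr hkB) hA' hB') isClosed_sphere (hA'.union hB')
      have hcl := (isClosed_sphere (x := (0 : C.J i → ℝ)) (ε := 1)).union (hA'.union hB')
      obtain ⟨h, hh⟩ := ContinuousMap.exists_restrict_eq hcl ⟨_, hk.domRestrict⟩
      have hh' : ∀ b ∈ (sphere 0 1 ∪
          (closedBall 0 1 ∩ C.Φ i ⁻¹' A ∪ closedBall 0 1 ∩ C.Φ i ⁻¹' B)), h b = k b :=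
        fun b hb => DFunLike.congr_fun hh ⟨b, hb⟩
      refine ⟨h, h.continuous.continuousOn, fun b hb => ?_, fun b hb => ⟨fun hbA => ?_, fun hbB => ?_⟩⟩
      · rw [hh' b (Or.inl hb)]; exact if_pos hb
      · rw [hh' b (Or.inr (Or.inl ⟨hb, hbA⟩))]; exact hkA b ⟨hb, hbA⟩
      · rw [hh' b (Or.inr (Or.inr ⟨hb, hbB⟩))]; exact hkB b ⟨hb, hbB⟩)
  have hfx : ∀ x, (x ∈ A → f x = 0) ∧ (x ∈ B → f x = 1) := by
    intro x
    have := hf (C.idx x) (C.coord x) (ball_subset_closedBall (C.coord_mem x))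
    simpa only [Function.comp, C.map_coord] using this
  refine ⟨f ⁻¹' Iio (1 / 2), f ⁻¹' Ioi (1 / 2), isOpen_Iio.preimage f.continuous,
    isOpen_Ioi.preimage f.continuous, fun x hx => ?_, fun x hx => ?_, ?_⟩
  · simp [(hfx x).1 hx]
  · simp only [mem_preimage, (hfx x).2 hx, mem_Ioi]; norm_num
  · refine Disjoint.preimage _ (disjoint_left.2 fun x hx hx' => ?_)
    exact lt_asymm (mem_Iio.1 hx) (mem_Ioi.1 hx')

end T2
end CellStructure

/-! ### Comparison with CW complexes; compact subsets -/

namespace CellStructure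

variable {X : Type u} [TopologicalSpace X]

/-- The cell structure underlying a CW complex. -/
noncomputable def ofCWComplex (C : CWComplex (univ : Set X)) : CellStructure X where
  ι := Σ n, RelCWComplex.cell (univ : Set X) n
  J i := Fin i.1
  Φ i := RelCWComplex.map i.1 i.2
  cont i := RelCWComplex.continuousOn i.1 i.2
  injOn i := by
    rw [← RelCWComplex.source_eq (C := (univ : Set X)) i.1 i.2]
    exact (RelCWComplex.map i.1 i.2).injOn
  disj i j x hx y hy h := by
    by_contra hne
    exact (CWComplex.disjoint_openCell_of_ne (i := i.2) (j := j.2) hne).ne_of_mem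
      ⟨x, hx, rfl⟩ ⟨y, hy, rfl⟩ h
  frontier i := by
    obtain ⟨F, hF⟩ := CWComplex.mapsTo i.1 i.2
    refine ⟨⋃ m ∈ Finset.range i.1, Sigma.mk m '' (F m), ?_, ?_, fun x hx => ?_⟩
    · exact (Finset.finite_toSet _).biUnion fun m _ => (F m).finite_toSet.image _
    · intro j hj
      simp only [mem_iUnion, mem_image] at hj
      obtain ⟨m, hm, k, -, rfl⟩ := hj
      simpa using hm
    · obtain ⟨m, hm, k, hk, h⟩ : ∃ m, ∃ (_ : m < i.1), ∃ k ∈ F m,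
          RelCWComplex.map i.1 i.2 x ∈ RelCWComplex.map m k '' closedBall 0 1 := by
        simpa only [mem_iUnion, exists_prop] using hF hx
      refine ⟨⟨m, k⟩, ?_, h⟩
      simp only [mem_iUnion, mem_image]
      exact ⟨m, by simpa using hm, k, hk, rfl⟩
  closed A h := CWComplex.closed' A (subset_univ _) fun n j => h ⟨n, j⟩
  cover x := by
    have h : x ∈ ⋃ (n : ℕ) (j : RelCWComplex.cell (univ : Set X) n), RelCWComplex.openCell n j := by
      rw [CWComplex.iUnion_openCell_eq_complex]; trivial
    simp only [mem_iUnion] at h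
    obtain ⟨n, j, b, hb, h⟩ := h
    exact ⟨⟨n, j⟩, b, hb, h⟩

variable (C : CellStructure X)

/-- Numbering of the coordinates of a cell of dimension `n`. -/
noncomputable def coordEquiv {n : ℕ} (i : {i : C.ι // C.dim i = n}) :
    (C.J i.1 → ℝ) ≃ᵢ (Fin n → ℝ) :=
  IsometryEquiv.piCongrLeft (Y := fun _ => ℝ) (Fintype.equivFinOfCardEq i.2)

lemma coordEquiv_zero {n : ℕ} (i : {i : C.ι // C.dim i = n}) : (C.coordEquiv i).symm 0 = 0 := rfl

lemma image_coordEquiv_ball {n : ℕ} (i : {i : C.ι // C.dim i = n}) :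
    (C.coordEquiv i).symm '' ball 0 1 = ball 0 1 := by
  rw [IsometryEquiv.image_ball, coordEquiv_zero]

lemma image_coordEquiv_closedBall {n : ℕ} (i : {i : C.ι // C.dim i = n}) :
    (C.coordEquiv i).symm '' closedBall 0 1 = closedBall 0 1 := by
  rw [IsometryEquiv.image_closedBall, coordEquiv_zero]

lemma image_coordEquiv_sphere {n : ℕ} (i : {i : C.ι // C.dim i = n}) :
    (C.coordEquiv i).symm '' sphere 0 1 = sphere 0 1 := by
  rw [IsometryEquiv.image_sphere, coordEquiv_zero]

lemma injOn_comp_coordEquiv {n : ℕ} (i : {i : C.ι // C.dim i = n}) :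
    InjOn (C.Φ i.1 ∘ (C.coordEquiv i).symm) (ball 0 1) :=
  (C.injOn i.1).comp (C.coordEquiv i).symm.injective.injOn
    (mapsTo_iff_image_subset.2 (C.image_coordEquiv_ball i).subset)

lemma continuousOn_comp_coordEquiv {n : ℕ} (i : {i : C.ι // C.dim i = n}) :
    ContinuousOn (C.Φ i.1 ∘ (C.coordEquiv i).symm) (closedBall 0 1) :=
  (C.cont i.1).comp (C.coordEquiv i).symm.continuous.continuousOn
    (mapsTo_iff_image_subset.2 (C.image_coordEquiv_closedBall i).subset)

/-- The characteristic map of a cell as a partial equivalence. -/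
noncomputable def partialEquiv {n : ℕ} (i : {i : C.ι // C.dim i = n}) :
    PartialEquiv (Fin n → ℝ) X :=
  (C.injOn_comp_coordEquiv i).toPartialEquiv _ _

lemma partialEquiv_image_ball {n : ℕ} (i : {i : C.ι // C.dim i = n}) :
    C.partialEquiv i '' ball 0 1 = C.Φ i.1 '' ball 0 1 := by
  change C.Φ i.1 ∘ (C.coordEquiv i).symm '' _ = _
  rw [image_comp, image_coordEquiv_ball]

lemma partialEquiv_image_closedBall {n : ℕ} (i : {i : C.ι // C.dim i = n}) :
    C.partialEquiv i '' closedBall 0 1 = C.Φ i.1 '' closedBall 0 1 := by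
  change C.Φ i.1 ∘ (C.coordEquiv i).symm '' _ = _
  rw [image_comp, image_coordEquiv_closedBall]

variable [T2Space X]

/-- A closed part of the cube has compact, hence closed, image. Intersecting that image with the
open cell adds no boundary points, because these lie in cells of smaller dimension. -/
lemma continuousOn_partialEquiv_symm {n : ℕ} (i : {i : C.ι // C.dim i = n}) :
    ContinuousOn (C.partialEquiv i).symm (C.partialEquiv i).target := by
  rw [continuousOn_iff_isClosed]
  intro t ht
  refine ⟨C.partialEquiv i '' (closedBall 0 1 ∩ t), ?_, ?_⟩
  · exact (((isCompact_closedBall _ _).inter_right ht).image_of_continuousOn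
      ((C.continuousOn_comp_coordEquiv i).mono inter_subset_left)).isClosed
  · ext x
    constructor
    · rintro ⟨hx, hxt⟩
      refine ⟨⟨_, ⟨?_, hx⟩, (C.partialEquiv i).right_inv hxt⟩, hxt⟩
      exact ball_subset_closedBall ((C.partialEquiv i).map_target hxt)
    · rintro ⟨⟨b, ⟨hb, hbt⟩, rfl⟩, hx⟩
      refine ⟨?_, hx⟩
      suffices h : b ∈ ball (0 : Fin n → ℝ) 1 by
        change (C.partialEquiv i).symm (C.partialEquiv i b) ∈ t
        rwa [(C.partialEquiv i).left_inv h]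
      have hx' : C.partialEquiv i b ∈ C.Φ i.1 '' ball 0 1 := by
        rw [← C.partialEquiv_image_ball i]; exact hx
      obtain ⟨c, hc, hcx⟩ := hx'
      have h1 : (C.coordEquiv i).symm b ∈ closedBall 0 1 := by
        rw [← C.image_coordEquiv_closedBall i]; exact ⟨b, hb, rfl⟩
      have h2 : C.idx (C.Φ i.1 ((C.coordEquiv i).symm b)) = i.1 := by
        change C.idx (C.partialEquiv i b) = i.1
        rw [← hcx, C.idx_map hc]
      have h3 := C.ball_of_idx_map h1 h2
      rw [← C.image_coordEquiv_ball i] at h3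
      obtain ⟨b', hb', h⟩ := h3
      rwa [← (C.coordEquiv i).symm.injective h]

/-- The CW complex defined by a cell structure on a Hausdorff space. -/
@[reducible]
noncomputable def toCWComplex : CWComplex (univ : Set X) where
  cell n := {i : C.ι // C.dim i = n}
  map n i := C.partialEquiv i
  source_eq n i := rfl
  continuousOn n i := C.continuousOn_comp_coordEquiv i
  continuousOn_symm n i := C.continuousOn_partialEquiv_symm i
  pairwiseDisjoint' := by
    rintro ⟨n, i, rfl⟩ - ⟨m, j, rfl⟩ - hne
    simp only [Function.onFun, partialEquiv_image_ball]
    rw [disjoint_left]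
    rintro x ⟨b, hb, rfl⟩ ⟨c, hc, h⟩
    obtain rfl := C.disj _ _ _ hc _ hb h
    exact hne rfl
  mapsTo' := by
    rintro n i
    obtain ⟨F, hfin, hF, hs⟩ := C.frontier i.1
    classical
    refine ⟨fun m => (hfin.preimage (Subtype.val_injective.injOn :
      InjOn (Subtype.val : {i : C.ι // C.dim i = m} → C.ι) _)).toFinset, fun x hx => ?_⟩
    have hx' : (C.coordEquiv i).symm x ∈ sphere 0 1 := by
      rw [← C.image_coordEquiv_sphere i]; exact ⟨x, hx, rfl⟩
    obtain ⟨j, hj, hxj⟩ := hs _ hx'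
    simp only [mem_iUnion, partialEquiv_image_closedBall]
    have := i.2
    exact ⟨C.dim j, by rw [← this]; exact hF j hj, ⟨j, rfl⟩, by simpa using hj, hxj⟩
  closed' A _ h := C.closed A fun i => by
    have := h (C.dim i) ⟨i, rfl⟩
    rwa [partialEquiv_image_closedBall] at this
  union' := by
    refine eq_univ_of_forall fun x => ?_
    simp only [mem_iUnion, partialEquiv_image_closedBall]
    exact ⟨_, ⟨C.idx x, rfl⟩, C.mem_cell x⟩

/-- A compact subset of a cell complex lies in finitely many closed cells. -/
theorem exists_finite_of_isCompact {K : Set X} (hK : IsCompact K) :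
    ∃ F : Set C.ι, F.Finite ∧ K ⊆ ⋃ i ∈ F, C.Φ i '' closedBall 0 1 := by
  refine ⟨C.idx '' K, ?_, fun x hx => mem_biUnion ⟨x, hx, rfl⟩ (C.mem_cell x)⟩
  by_contra hinf
  -- `S` contains one point of `K` from each open cell that `K` meets. A closed cell meets finitely
  -- many open cells, so every subset of `S` is closed; thus `S` is compact and discrete, hence
  -- finite.
  obtain ⟨S, hSK, hS⟩ := (surjOn_image C.idx K).exists_bijOn_subset
  have hfin : ∀ i, {k | ∃ x ∈ C.Φ i '' closedBall 0 1, C.idx x = k}.Finite := by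
    intro i
    induction hn : C.dim i using Nat.strong_induction_on generalizing i with
    | _ n ih =>
      obtain ⟨F, hF, hlt, hs⟩ := C.frontier i
      refine ((finite_singleton i).union (hF.biUnion fun j hj =>
        ih _ (hn ▸ hlt j hj) j rfl)).subset ?_
      rintro k ⟨_, ⟨b, hb, rfl⟩, rfl⟩
      rcases (mem_closedBall.1 hb).lt_or_eq with h | h
      · exact Or.inl (C.idx_map (mem_ball.2 h))
      · obtain ⟨j, hj, hbj⟩ := hs b (mem_sphere.2 h)
        exact Or.inr (mem_biUnion hj ⟨_, hbj, rfl⟩)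
  have hcl : ∀ T ⊆ S, IsClosed T := by
    intro T hT
    refine C.closed T fun i => Set.Finite.isClosed ?_
    refine Set.Finite.of_finite_image ((hfin i).subset ?_) (hS.injOn.mono (inter_subset_left.trans hT))
    rintro _ ⟨x, ⟨-, hx⟩, rfl⟩
    exact ⟨x, hx, rfl⟩
  have hSc : IsCompact S := hK.of_isClosed_subset (hcl S subset_rfl) hSK
  have hSd : IsDiscrete S := by
    rw [isDiscrete_iff_forall_mem_exists_isOpen]
    intro x hx
    refine ⟨(S \ {x})ᶜ, (hcl _ sdiff_subset).isOpen_compl, ?_⟩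
    ext y
    simp only [mem_inter_iff, mem_compl_iff, mem_sdiff, mem_singleton_iff]
    constructor
    · rintro ⟨h, hy⟩
      by_contra hne
      exact h ⟨hy, hne⟩
    · rintro rfl
      exact ⟨fun h => h.2 rfl, hx⟩
  have hSf : S.Finite := hSc.finite hSd
  exact hinf (hS.image_eq ▸ hSf.image _)

/-- A cell complex is compactly generated. -/
theorem compactlyCoherentSpace (C : CellStructure X) : CompactlyCoherentSpace X := by
  refine .of_isClosed fun A hA => C.closed A fun i => ?_
  have hK := C.isCompact_cell i
  have := (hK.isClosed.isClosedEmbedding_subtypeVal).isClosedMap _ (hA _ hK)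
  rwa [Subtype.image_preimage_coe, inter_comm] at this

end CellStructure

namespace PtdSpace

theorem isCW_iff (X : PtdSpace.{u}) :
    X.IsCW ↔ T2Space X ∧ ∃ (C : CellStructure X) (i : C.ι), IsEmpty (C.J i) ∧
      ∀ b, C.Φ i b = X.pt := by
  refine and_congr_right fun _ => ⟨?_, ?_⟩
  · rintro ⟨C, i, hi⟩
    refine ⟨.ofCWComplex C, ⟨0, i⟩, inferInstanceAs (IsEmpty (Fin 0)), fun b => ?_⟩
    rw [← hi]
    exact congrArg (C.map 0 i) (Subsingleton.elim (α := Fin 0 → ℝ) _ _)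
  · rintro ⟨C, i, hi, hb⟩
    refine ⟨C.toCWComplex, ⟨i, ?_⟩, hb _⟩
    exact Fintype.card_eq_zero_iff.2 hi

end PtdSpace

/-! ### Collapsing a subset to a point -/

/-- `f` is a quotient map that identifies the points of `N` with each other, and nothing else. -/
structure IsCollapse {W P : Type*} [TopologicalSpace W] [TopologicalSpace P] (f : W → P)
    (N : Set W) : Prop where
  isQuotientMap : IsQuotientMap f
  eq_iff : ∀ w w', f w = f w' ↔ w = w' ∨ (w ∈ N ∧ w' ∈ N)

namespace IsCollapse

variable {W V P Q : Type*} [TopologicalSpace W] [TopologicalSpace V] [TopologicalSpace P]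
  [TopologicalSpace Q] {f : W → P} {N : Set W}

lemma eq_of_mem (hf : IsCollapse f N) {w w' : W} (h : w ∈ N) (h' : w' ∈ N) : f w = f w' :=
  (hf.eq_iff w w').2 (Or.inr ⟨h, h'⟩)

lemma mem_iff (hf : IsCollapse f N) {w w' : W} (h : f w = f w') : w ∈ N ↔ w' ∈ N := by
  rcases (hf.eq_iff w w').1 h with rfl | ⟨h1, h2⟩
  · rfl
  · exact iff_of_true h1 h2

/-- Two quotients of a space collapsing the same subset are homeomorphic. -/
lemma exists_homeomorph (hf : IsCollapse f N) {g : W → Q} (hg : IsCollapse g N) :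
    ∃ e : P ≃ₜ Q, ∀ w, e (f w) = g w := by
  have h1 : ∀ w w', f w = f w' ↔ g w = g w' := fun w w' => by rw [hf.eq_iff, hg.eq_iff]
  let a : P → Q := fun p => g (surjInv hf.isQuotientMap.surjective p)
  let b : Q → P := fun p => f (surjInv hg.isQuotientMap.surjective p)
  have ha : ∀ w, a (f w) = g w := fun w => (h1 _ _).1 (surjInv_eq _ _)
  have hb : ∀ w, b (g w) = f w := fun w => (h1 _ _).2 (surjInv_eq _ _)
  have hba : LeftInverse b a := fun p => by
    obtain ⟨w, hw⟩ := hf.isQuotientMap.surjective p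
    rw [← hw, ha, hb]
  have hab : RightInverse b a := fun q => by
    obtain ⟨w, hw⟩ := hg.isQuotientMap.surjective q
    rw [← hw, hb, ha]
  refine ⟨⟨⟨a, b, hba, hab⟩, ?_, ?_⟩, ha⟩
  · exact hf.isQuotientMap.continuous_iff.2
      ((funext ha : a ∘ f = g) ▸ hg.isQuotientMap.continuous)
  · exact hg.isQuotientMap.continuous_iff.2
      ((funext hb : b ∘ g = f) ▸ hf.isQuotientMap.continuous)

/-- Used to collapse in two stages: the first quotient map may only identify points that the second
one collapses anyway. -/
lemma comp {q : W → V} (hq : IsQuotientMap q) {r : V → P} {M : Set V} (hr : IsCollapse r M)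
    (h : ∀ w w', q w = q w' → w = w' ∨ (q w ∈ M ∧ q w' ∈ M)) :
    IsCollapse (r ∘ q) (q ⁻¹' M) := by
  refine ⟨hr.isQuotientMap.comp hq, fun w w' => ?_⟩
  simp only [Function.comp, hr.eq_iff, mem_preimage]
  constructor
  · rintro (h' | h')
    · exact h w w' h'
    · exact Or.inr h'
  · rintro (rfl | h')
    · exact Or.inl rfl
    · exact Or.inr h'

lemma comp_homeomorph (hf : IsCollapse f N) (e : V ≃ₜ W) : IsCollapse (f ∘ e) (e ⁻¹' N) :=
  hf.comp e.isQuotientMap fun _ _ h => Or.inl (e.injective h)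

/-- An open set that contains `N` or misses it is saturated. -/
lemma isOpen_image (hf : IsCollapse f N) {U : Set W} (hU : IsOpen U)
    (h : N ⊆ U ∨ Disjoint N U) : IsOpen (f '' U) := by
  rw [← hf.isQuotientMap.isOpen_preimage]
  convert hU using 1
  refine Subset.antisymm ?_ (subset_preimage_image f U)
  rintro x ⟨y, hy, hxy⟩
  rcases (hf.eq_iff y x).1 hxy with rfl | ⟨hyN, hxN⟩
  · exact hy
  · rcases h with h | h
    · exact h hxN
    · exact absurd hy (disjoint_left.1 h hyN)

/-- The quotient of a normal Hausdorff space by a closed subset is Hausdorff. -/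
lemma t2Space [T2Space W] [NormalSpace W] (hf : IsCollapse f N) (hN : IsClosed N) :
    T2Space P := by
  have key : ∀ x y, f x ≠ f y → y ∉ N → ∃ U V : Set W, IsOpen U ∧ IsOpen V ∧ x ∈ U ∧ y ∈ V ∧
      (N ⊆ U ∨ Disjoint N U) ∧ Disjoint N V ∧ Disjoint U V := by
    intro x y hxy hy
    by_cases hx : x ∈ N
    · obtain ⟨U, V, hU, hV, hNU, hyV, hUV⟩ := normal_separation hN (isClosed_singleton (x := y))
        (disjoint_singleton_right.2 hy)
      exact ⟨U, V, hU, hV, hNU hx, hyV rfl, Or.inl hNU, hUV.mono_left hNU, hUV⟩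
    · obtain ⟨U, V, hU, hV, hxU, hyV, hUV⟩ := t2_separation (fun h : x = y => hxy (h ▸ rfl))
      refine ⟨U ∩ Nᶜ, V ∩ Nᶜ, hU.inter hN.isOpen_compl, hV.inter hN.isOpen_compl, ⟨hxU, hx⟩,
        ⟨hyV, hy⟩, Or.inr ?_, ?_, hUV.mono inter_subset_left inter_subset_left⟩ <;>
      exact disjoint_left.2 fun z hz hz' => hz'.2 hz
  have key' : ∀ x y, f x ≠ f y → y ∉ N → ∃ U V : Set P, IsOpen U ∧ IsOpen V ∧ f x ∈ U ∧ f y ∈ V ∧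
      Disjoint U V := by
    intro x y hxy hy
    obtain ⟨U, V, hU, hV, hxU, hyV, hNU, hNV, hUV⟩ := key x y hxy hy
    refine ⟨f '' U, f '' V, hf.isOpen_image hU hNU, hf.isOpen_image hV (Or.inr hNV), ⟨x, hxU, rfl⟩,
      ⟨y, hyV, rfl⟩, disjoint_left.2 ?_⟩
    rintro _ ⟨a, ha, rfl⟩ ⟨b, hb, hab⟩
    rcases (hf.eq_iff b a).1 hab with rfl | ⟨h, -⟩
    · exact disjoint_left.1 hUV ha hb
    · exact disjoint_left.1 hNV h hb
  refine ⟨fun p q hpq => ?_⟩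
  obtain ⟨x, rfl⟩ := hf.isQuotientMap.surjective p
  obtain ⟨y, rfl⟩ := hf.isQuotientMap.surjective q
  by_cases hy : y ∈ N
  · have hx : x ∉ N := fun hx => hpq (hf.eq_of_mem hx hy)
    obtain ⟨U, V, hU, hV, h1, h2, h3⟩ := key' y x hpq.symm hx
    exact ⟨V, U, hV, hU, h2, h1, h3.symm⟩
  · exact key' x y hpq hy

end IsCollapse

/-! ### Cell structures on quotients, disjoint unions and products -/

namespace CellStructure

section Quotient

variable {X Y : Type u} [TopologicalSpace X] [TopologicalSpace Y] (C : CellStructure X)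

/-- The closed ball is the closure of the open one, and `N` is closed. -/
lemma image_closedBall_subset {N : Set X} (hN : IsClosed N) {i : C.ι}
    (h : ∀ b ∈ ball 0 1, C.Φ i b ∈ N) : C.Φ i '' closedBall 0 1 ⊆ N := by
  rw [← closure_ball _ one_ne_zero]
  refine (ContinuousOn.image_closure ?_).trans (closure_minimal ?_ hN)
  · rw [closure_ball _ one_ne_zero]; exact C.cont i
  · rintro _ ⟨b, hb, rfl⟩; exact h b hb

/-- The cell structure on the quotient by a subcomplex `N` containing a vertex `v`. -/
noncomputable def quotient [T2Space X] {f : X → Y} {N : Set X} (hf : IsCollapse f N)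
    (hN : IsClosed N)
    (hsat : ∀ i, ∀ b ∈ ball 0 1, ∀ b' ∈ ball 0 1, C.Φ i b ∈ N → C.Φ i b' ∈ N)
    (v : C.ι) (hv : IsEmpty (C.J v)) (hvN : ∀ b, C.Φ v b ∈ N) : CellStructure Y where
  -- By `hsat` an open cell lies in `N` or misses it, so its centre decides. The vertex `v` stands
  -- for the point to which `N` is collapsed.
  ι := {i : C.ι // i = v ∨ C.Φ i 0 ∉ N}
  J i := C.J i.1
  Φ i := f ∘ C.Φ i.1
  cont i := hf.isQuotientMap.continuous.comp_continuousOn (C.cont i.1)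
  injOn i b hb b' hb' h := by
    rcases (hf.eq_iff _ _).1 h with h | ⟨h, h'⟩
    · exact C.injOn _ hb hb' h
    · rcases i.2 with hi | hi
      · have : IsEmpty (C.J i.1) := by rw [hi]; exact hv
        exact Subsingleton.elim _ _
      · exact absurd (hsat _ b hb 0 (mem_ball_self one_pos) h) hi
  disj i j b hb c hc h := by
    rcases (hf.eq_iff _ _).1 h with h | ⟨h, h'⟩
    · exact Subtype.ext (C.disj _ _ _ hb _ hc h)
    · have hi := i.2.resolve_right (not_not.2 (hsat _ b hb 0 (mem_ball_self one_pos) h))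
      have hj := j.2.resolve_right (not_not.2 (hsat _ c hc 0 (mem_ball_self one_pos) h'))
      exact Subtype.ext (hi.trans hj.symm)
  frontier i := by
    obtain ⟨F, hfin, hF, hs⟩ := C.frontier i.1
    refine ⟨{j | (j.1 = v ∨ j.1 ∈ F) ∧ Fintype.card (C.J j.1) < Fintype.card (C.J i.1)},
      ((hfin.insert v).preimage Subtype.val_injective.injOn).subset fun j hj => hj.1,
      fun j hj => hj.2, fun x hx => ?_⟩
    obtain ⟨j, hj, c, hc, hcx⟩ := hs x hx
    by_cases hxN : C.Φ i.1 x ∈ N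
    -- Boundary points in `N` move to the vertex. It has smaller dimension than the cell, because
    -- the boundary already met a cell of smaller dimension.
    · refine ⟨⟨v, Or.inl rfl⟩, ⟨Or.inl rfl, ?_⟩, 0, mem_closedBall_self zero_le_one,
        hf.eq_of_mem (hvN _) hxN⟩
      rw [Fintype.card_eq_zero_iff.2 hv]
      exact (Nat.zero_le _).trans_lt (hF j hj)
    · refine ⟨⟨j, Or.inr fun h => hxN ?_⟩, ⟨Or.inr hj, hF j hj⟩, c, hc, congrArg f hcx⟩
      rw [← hcx]
      exact C.image_closedBall_subset hN
        (fun b hb => hsat j 0 (mem_ball_self one_pos) b hb h) ⟨c, hc, rfl⟩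
  closed A hA := by
    rw [← hf.isQuotientMap.isClosed_preimage]
    refine C.closed _ fun i => ?_
    have hcl := (C.isCompact_cell i).isClosed
    by_cases hi : i = v ∨ C.Φ i 0 ∉ N
    · convert ((hA ⟨i, hi⟩).preimage hf.isQuotientMap.continuous).inter hcl using 1
      ext x
      simp only [mem_inter_iff, mem_preimage]
      refine ⟨fun ⟨h1, h2⟩ => ⟨⟨h1, ?_⟩, h2⟩, fun ⟨h1, h2⟩ => ⟨h1.1, h2⟩⟩
      rw [image_comp]
      exact mem_image_of_mem f h2
    · push Not at hi
      have hsub := C.image_closedBall_subset hN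
        (fun b hb => hsat i 0 (mem_ball_self one_pos) b hb hi.2)
      by_cases h0 : f (C.Φ v 0) ∈ A
      · rw [inter_eq_right.2]
        · exact hcl
        · intro x hx
          rw [mem_preimage, hf.eq_of_mem (hsub hx) (hvN 0)]
          exact h0
      · convert isClosed_empty
        refine eq_empty_of_forall_notMem fun x hx => h0 ?_
        rw [hf.eq_of_mem (hvN 0) (hsub hx.2)]
        exact hx.1
  cover y := by
    obtain ⟨x, rfl⟩ := hf.isQuotientMap.surjective y
    by_cases hx : x ∈ N
    · exact ⟨⟨v, Or.inl rfl⟩, 0, mem_ball_self one_pos, hf.eq_of_mem (hvN _) hx⟩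
    · refine ⟨⟨C.idx x, Or.inr fun h => hx ?_⟩, C.coord x, C.coord_mem x,
        congrArg f (C.map_coord x)⟩
      rw [← C.map_coord x]
      exact hsat _ 0 (mem_ball_self one_pos) _ (C.coord_mem x) h

end Quotient

/-- The cell structure on a disjoint union. -/
def sigma {κ : Type} {X : κ → Type u} [∀ k, TopologicalSpace (X k)]
    (C : ∀ k, CellStructure (X k)) : CellStructure (Σ k, X k) where
  ι := Σ k, (C k).ι
  J i := (C i.1).J i.2
  Φ i b := ⟨i.1, (C i.1).Φ i.2 b⟩
  cont i := continuous_sigmaMk.comp_continuousOn ((C i.1).cont i.2)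
  injOn i b hb b' hb' h := (C i.1).injOn i.2 hb hb' (sigma_mk_injective h)
  disj i j b hb c hc h := by
    obtain ⟨k, i⟩ := i
    obtain ⟨l, j⟩ := j
    obtain rfl : k = l := congrArg Sigma.fst h
    rw [(C k).disj i j b hb c hc (sigma_mk_injective h)]
  frontier i := by
    obtain ⟨F, hfin, hF, hs⟩ := (C i.1).frontier i.2
    refine ⟨Sigma.mk i.1 '' F, hfin.image _, ?_, fun x hx => ?_⟩
    · rintro _ ⟨j, hj, rfl⟩; exact hF j hj
    · obtain ⟨j, hj, c, hc, hcx⟩ := hs x hx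
      exact ⟨_, ⟨j, hj, rfl⟩, c, hc, congrArg (Sigma.mk i.1) hcx⟩
  closed A hA := by
    refine isClosed_sigma_iff.2 fun k => (C k).closed _ fun i => ?_
    convert (hA ⟨k, i⟩).preimage (continuous_sigmaMk (i := k)) using 1
    ext x
    simp only [mem_inter_iff, mem_preimage, mem_image]
    refine and_congr_right fun _ => exists_congr fun b => and_congr_right fun _ => ?_
    exact ⟨fun h => by rw [h], fun h => sigma_mk_injective h⟩
  cover x := ⟨⟨x.1, (C x.1).idx x.2⟩, (C x.1).coord x.2, (C x.1).coord_mem x.2,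
    by rw [(C x.1).map_coord]⟩

section Pi

variable {κ : Type} [Fintype κ] {X : κ → Type u} [∀ k, TopologicalSpace (X k)]
  (C : ∀ k, CellStructure (X k))

lemma mem_ball_sigma {c : ∀ k, (C k).ι} {b : (Σ k, (C k).J (c k)) → ℝ} :
    b ∈ ball 0 1 ↔ ∀ k, (fun j => b ⟨k, j⟩) ∈ ball (0 : (C k).J (c k) → ℝ) 1 := by
  simp only [mem_ball_zero_iff, pi_norm_lt_iff one_pos, Sigma.forall]

lemma mem_closedBall_sigma {c : ∀ k, (C k).ι} {b : (Σ k, (C k).J (c k)) → ℝ} :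
    b ∈ closedBall 0 1 ↔ ∀ k, (fun j => b ⟨k, j⟩) ∈ closedBall (0 : (C k).J (c k) → ℝ) 1 := by
  simp only [mem_closedBall_zero_iff, pi_norm_le_iff_of_nonneg zero_le_one, Sigma.forall]

/-- The characteristic map of a product of cells. -/
def piMap (c : ∀ k, (C k).ι) (b : (Σ k, (C k).J (c k)) → ℝ) (k : κ) : X k :=
  (C k).Φ (c k) fun j => b ⟨k, j⟩

lemma continuousOn_piMap (c : ∀ k, (C k).ι) : ContinuousOn (piMap C c) (closedBall 0 1) := by
  refine continuousOn_pi.2 fun k => ((C k).cont (c k)).comp ?_ fun b hb => ?_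
  · exact (continuous_pi fun j => continuous_apply _).continuousOn
  · exact (mem_closedBall_sigma C).1 hb k

lemma piMap_image (c : ∀ k, (C k).ι) :
    piMap C c '' closedBall 0 1 = {p | ∀ k, p k ∈ (C k).Φ (c k) '' closedBall 0 1} := by
  ext p
  constructor
  · rintro ⟨b, hb, rfl⟩ k
    exact ⟨_, (mem_closedBall_sigma C).1 hb k, rfl⟩
  · intro h
    choose b hb hp using h
    exact ⟨fun s => b s.1 s.2, (mem_closedBall_sigma C).2 hb, funext hp⟩

/-- The cell structure on a finite product with the compactly generated topology. -/
noncomputable def pi [∀ k, T2Space (X k)] : CellStructure (𝐤 (∀ k, X k)) where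
  ι := ∀ k, (C k).ι
  J c := Σ k, (C k).J (c k)
  Φ c := CompactCoherentification.mk _ ∘ piMap C c
  cont c := (CompactCoherentification.continuousOn_mk_comp_iff_of_Compact
    (isCompact_closedBall _ _)).2 (continuousOn_piMap C c)
  injOn c b hb b' hb' h := by
    have h := congrFun ((CompactCoherentification.mk _).injective h)
    funext ⟨k, j⟩
    exact congrFun ((C k).injOn (c k) ((mem_ball_sigma C).1 hb k) ((mem_ball_sigma C).1 hb' k)
      (h k)) j
  disj c d b hb b' hb' h := by
    have h := congrFun ((CompactCoherentification.mk _).injective h)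
    funext k
    exact (C k).disj _ _ _ ((mem_ball_sigma C).1 hb k) _ ((mem_ball_sigma C).1 hb' k) (h k)
  frontier c := by
    classical
    choose F hfin hF hs using fun k => (C k).frontier (c k)
    -- The boundary of a product of cubes consists of the points with some coordinate block on the
    -- boundary of its factor; only that factor is replaced by a lower cell.
    refine ⟨⋃ k, Function.update c k '' F k, finite_iUnion fun k => (hfin k).image _, ?_, ?_⟩
    · intro d hd
      obtain ⟨k, j, hj, rfl⟩ : ∃ k, ∃ j ∈ F k, Function.update c k j = d := by
        simpa only [mem_iUnion, mem_image] using hd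
      rw [Fintype.card_sigma, Fintype.card_sigma]
      refine Finset.sum_lt_sum (fun l _ => ?_) ⟨k, Finset.mem_univ _, ?_⟩
      · by_cases h : l = k
        · subst h; rw [Function.update_self]; exact (hF l j hj).le
        · rw [Function.update_of_ne h]
      · rw [Function.update_self]; exact hF k j hj
    · intro x hx
      have hxc := (mem_closedBall_sigma C).1 (sphere_subset_closedBall hx)
      obtain ⟨k, hk⟩ : ∃ k, (fun j => x ⟨k, j⟩) ∉ ball (0 : (C k).J (c k) → ℝ) 1 := by
        by_contra! h
        exact (mem_sphere.1 hx).not_lt (mem_ball.1 ((mem_ball_sigma C).2 h))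
      have hk' : (fun j => x ⟨k, j⟩) ∈ sphere (0 : (C k).J (c k) → ℝ) 1 :=
        mem_sphere.2 (le_antisymm (mem_closedBall.1 (hxc k)) (not_lt.1 hk))
      obtain ⟨j, hj, hxj⟩ := hs k _ hk'
      refine ⟨Function.update c k j, mem_iUnion.2 ⟨k, j, hj, rfl⟩, ?_⟩
      rw [image_comp, piMap_image]
      refine mem_image_of_mem _ fun l => ?_
      by_cases h : l = k
      · subst h; rw [Function.update_self]; exact hxj
      · rw [Function.update_of_ne h]; exact ⟨_, hxc l, rfl⟩
  closed A hA := by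
    rw [CompactCoherentification.isClosed_iff]
    intro K hK
    -- Each projection of `K` lies in finitely many closed cells, so finitely many product cells
    -- cover `K`. This is why the compactly generated topology is the cellular one.
    choose F hfin hF using fun k =>
      (C k).exists_finite_of_isCompact (hK.image (continuous_apply k))
    have hcl : ∀ c, IsClosed (CompactCoherentification.mk (∀ k, X k) ⁻¹' A ∩
        piMap C c '' closedBall 0 1) := by
      intro c
      have h1 : IsCompact (A ∩ (CompactCoherentification.mk _ ∘ piMap C c) '' closedBall 0 1) :=
        ((isCompact_closedBall _ _).image_of_continuousOn
          ((CompactCoherentification.continuousOn_mk_comp_iff_of_Compact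
            (isCompact_closedBall _ _)).2 (continuousOn_piMap C c))).of_isClosed_subset (hA c)
          inter_subset_right
      rw [CompactCoherentification.isCompact_iff, preimage_inter, image_comp,
        preimage_image_eq _ (Equiv.injective _)] at h1
      exact h1.isClosed
    have hfinG : {c : ∀ k, (C k).ι | ∀ k, c k ∈ F k}.Finite := by
      simpa [Set.pi] using Set.Finite.pi (ι := κ) hfin
    have hcl' := hfinG.isClosed_biUnion fun c _ => hcl c
    convert hcl'.preimage (continuous_subtype_val (p := (· ∈ K))) using 1
    ext ⟨p, hp⟩
    simp only [mem_preimage, mem_iUnion, mem_inter_iff, exists_prop]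
    constructor
    · intro h
      have h2 : ∀ k, ∃ i ∈ F k, p k ∈ (C k).Φ i '' closedBall 0 1 := fun k => by
        simpa only [mem_iUnion, exists_prop] using hF k ⟨p, hp, rfl⟩
      choose c hc hpc using h2
      exact ⟨c, hc, h, by rw [piMap_image]; exact hpc⟩
    · rintro ⟨c, -, h, -⟩
      exact h
  cover p := ⟨fun k => (C k).idx ((CompactCoherentification.mk _).symm p k),
    fun s => (C s.1).coord ((CompactCoherentification.mk _).symm p s.1) s.2,
    (mem_ball_sigma C).2 fun k => (C k).coord_mem _, by
      refine (CompactCoherentification.mk _).symm.injective (funext fun k => ?_)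
      exact (C k).map_coord _⟩

end Pi

end CellStructure

/-! ### Wedges, products and smash products are CW complexes -/

namespace PtdSpace

/-- The projection to a quotient space `Z / A`. -/
def collapseMk {Z : Type u} [TopologicalSpace Z] (A : Set Z) (a : Z) (z : Z) : collapse Z A a :=
  Quotient.mk (collapseSetoid A) z

lemma isCollapse_collapseMk {Z : Type u} [TopologicalSpace Z] (A : Set Z) (a : Z) :
    IsCollapse (collapseMk A a) A :=
  ⟨isQuotientMap_quotient_mk', fun _ _ => Quotient.eq (r := collapseSetoid A)⟩

lemma collapseMk_eq_pt {Z : Type u} [TopologicalSpace Z] {A : Set Z} {a : Z} (ha : a ∈ A) {z : Z}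
    (hz : z ∈ A) : collapseMk A a z = (collapse Z A a).pt :=
  (isCollapse_collapseMk A a).eq_of_mem hz ha

theorem isCW_collapse {Z : Type u} [TopologicalSpace Z] [T2Space Z] (C : CellStructure Z)
    {A : Set Z} {a : Z} (ha : a ∈ A) (hA : IsClosed A)
    (hsat : ∀ i, ∀ b ∈ ball 0 1, ∀ b' ∈ ball 0 1, C.Φ i b ∈ A → C.Φ i b' ∈ A)
    (v : C.ι) (hv : IsEmpty (C.J v)) (hvA : ∀ b, C.Φ v b ∈ A) : (collapse Z A a).IsCW := by
  have := C.normalSpace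
  have hc := isCollapse_collapseMk A a
  exact (isCW_iff _).2 ⟨hc.t2Space hA, C.quotient hc hA hsat v hv hvA, ⟨v, Or.inl rfl⟩, hv,
    fun b => collapseMk_eq_pt ha (hvA b)⟩

theorem IsCW.wedge {κ : Type} [Nonempty κ] {X : κ → PtdSpace.{u}} (h : ∀ k, (X k).IsCW) :
    (wedge X).IsCW := by
  have : ∀ k, T2Space (X k) := fun k => (h k).1
  choose C v hv hvb using fun k => ((isCW_iff _).1 (h k)).2
  refine isCW_collapse (.sigma C) (by rfl) ?_ ?_
    ⟨Classical.arbitrary κ, v (Classical.arbitrary κ)⟩ (hv (Classical.arbitrary κ)) fun b => hvb _ b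
  · refine isClosed_sigma_iff.2 fun k => ?_
    exact isClosed_singleton (x := (X k).pt)
  · rintro ⟨k, i⟩ b hb b' hb' (hi : (C k).Φ i b = _)
    obtain rfl : i = v k := (C k).disj _ _ _ hb 0 (mem_ball_self one_pos) (hi.trans (hvb k 0).symm)
    exact hvb k b'

section

variable {κ : Type} [Fintype κ] {X : κ → PtdSpace.{u}}

theorem IsCW.prod (h : ∀ k, (X k).IsCW) : (prod X).IsCW := by
  have : ∀ k, T2Space (X k) := fun k => (h k).1
  choose C v hv hvb using fun k => ((isCW_iff _).1 (h k)).2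
  refine (isCW_iff _).2 ⟨inferInstanceAs (T2Space (𝐤 (∀ k, X k))), .pi C, v,
    ⟨fun x => (hv x.1).false x.2⟩, fun b => ?_⟩
  exact congrArg (CompactCoherentification.mk _) (funext fun k => hvb k _)

/-- The quotient of a product of based CW complexes by the subcomplex of the points with some
coordinate in `S` equal to the base point is a CW complex. -/
theorem IsCW.collapse_prod (h : ∀ k, (X k).IsCW) {S : Set κ} (hS : S.Nonempty) :
    (collapse (𝐤 (∀ k, X k))
      {p | ∃ k ∈ S, (CompactCoherentification.mk (∀ k, X k)).symm p k = (X k).pt}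
      (CompactCoherentification.mk _ fun k => (X k).pt)).IsCW := by
  have : ∀ k, T2Space (X k) := fun k => (h k).1
  choose C v hv hvb using fun k => ((isCW_iff _).1 (h k)).2
  obtain ⟨s, hs⟩ := hS
  refine isCW_collapse (.pi C) ⟨s, hs, rfl⟩ ?_ ?_ v ⟨fun x => (hv x.1).false x.2⟩
    fun b => ⟨s, hs, hvb s _⟩
  · have : {p | ∃ k ∈ S, (CompactCoherentification.mk (∀ k, X k)).symm p k = (X k).pt} =
        ⋃ k ∈ S, {p | (CompactCoherentification.mk (∀ k, X k)).symm p k = (X k).pt} := by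
      ext p; simp
    rw [this]
    refine (toFinite S).isClosed_biUnion fun k _ => ?_
    have hc : Continuous fun p => (CompactCoherentification.mk (∀ k, X k)).symm p k :=
      (continuous_apply k).comp CompactCoherentification.continuous_mk_symm
    exact isClosed_singleton.preimage hc
  · rintro c b hb b' hb' ⟨k, hk, hi⟩
    refine ⟨k, hk, ?_⟩
    -- The base point lies in no open cell other than its vertex, so the whole open product cell has
    -- base point coordinate `k`.
    have h1 : c k = v k := (C k).disj _ _ _ ((CellStructure.mem_ball_sigma C).1 hb k) 0
      (mem_ball_self one_pos) (Eq.trans hi (hvb k 0).symm)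
    change (C k).Φ (c k) _ = _
    have h2 : ∀ j, j = v k → ∀ b, (C k).Φ j b = (X k).pt := by rintro _ rfl b; exact hvb k b
    exact h2 _ h1 _

end

end PtdSpace

/-! ### Homotopy extension and well-pointedness -/

/-- The homotopy extension property of the cube relative to its boundary, with control over the
values of the extension. -/
lemma exists_homotopy_extension_closedBall {J : Type} [Fintype J] {Y : Type*} [TopologicalSpace Y]
    (φ : (J → ℝ) → Y) (hφ : ContinuousOn φ (closedBall 0 1)) (g : (J → ℝ) → C(I, Y))
    (hg : ContinuousOn g (sphere 0 1)) (hg0 : ∀ b ∈ sphere 0 1, g b 0 = φ b) :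
    ∃ h : (J → ℝ) → C(I, Y), ContinuousOn h (closedBall 0 1) ∧ EqOn h g (sphere 0 1) ∧
      (∀ b ∈ closedBall 0 1, h b 0 = φ b) ∧
      ∀ b ∈ closedBall 0 1, ∀ t, (∃ b' ∈ closedBall 0 1, h b t = φ b') ∨
        ∃ b' ∈ sphere 0 1, ∃ t', h b t = g b' t' := by
  classical
  -- The cylinder is projected from the point `(0, 2)` above it onto its side and bottom. Points of
  -- `S₁` hit the side, at height `τ`; points of `S₂` hit the bottom.
  let S₁ : Set ((J → ℝ) × I) := {p | ‖p.1‖ ≤ 1 ∧ 1 - (p.2 : ℝ) / 2 ≤ ‖p.1‖}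
  let S₂ : Set ((J → ℝ) × I) := {p | ‖p.1‖ ≤ 1 ∧ ‖p.1‖ ≤ 1 - (p.2 : ℝ) / 2}
  have hS₁ : IsClosed S₁ := by
    have h : Continuous fun p : (J → ℝ) × I => 1 - (p.2 : ℝ) / 2 := by fun_prop
    exact (isClosed_le continuous_fst.norm continuous_const).inter
      (isClosed_le h continuous_fst.norm)
  have hS₂ : IsClosed S₂ := by
    have h : Continuous fun p : (J → ℝ) × I => 1 - (p.2 : ℝ) / 2 := by fun_prop
    exact (isClosed_le continuous_fst.norm continuous_const).inter
      (isClosed_le continuous_fst.norm h)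
  let τ : (J → ℝ) × I → I := fun p => projIcc 0 1 zero_le_one (2 - (2 - (p.2 : ℝ)) / ‖p.1‖)
  let v₁ : (J → ℝ) × I → Y := fun p => g (‖p.1‖⁻¹ • p.1) (τ p)
  let v₂ : (J → ℝ) × I → Y := fun p => φ ((1 - (p.2 : ℝ) / 2)⁻¹ • p.1)
  have hpos : ∀ t : I, (0 : ℝ) < 1 - (t : ℝ) / 2 := fun t => by linarith [t.2.2]
  have hn : ∀ p ∈ S₁, 0 < ‖p.1‖ := fun p hp => (hpos p.2).trans_le hp.2
  have hsph : ∀ p ∈ S₁, ‖p.1‖⁻¹ • p.1 ∈ sphere (0 : J → ℝ) 1 := by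
    intro p hp
    rw [mem_sphere_zero_iff_norm, norm_smul, norm_inv, norm_norm, inv_mul_cancel₀ (hn p hp).ne']
  have hball : ∀ p ∈ S₂, (1 - (p.2 : ℝ) / 2)⁻¹ • p.1 ∈ closedBall (0 : J → ℝ) 1 := by
    intro p hp
    rw [mem_closedBall_zero_iff, norm_smul, norm_inv, Real.norm_of_nonneg (hpos _).le,
      inv_mul_le_one₀ (hpos _)]
    exact hp.2
  have hv₁ : ContinuousOn v₁ S₁ := by
    have hc : ContinuousOn (fun p : (J → ℝ) × I => g (‖p.1‖⁻¹ • p.1)) S₁ :=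
      hg.comp ((continuous_fst.norm.continuousOn.inv₀ fun p hp => (hn p hp).ne').smul
        continuous_fst.continuousOn) hsph
    have ht : ContinuousOn τ S₁ := by
      refine continuous_projIcc.comp_continuousOn (continuousOn_const.sub ?_)
      exact ContinuousOn.div (by fun_prop) (by fun_prop) fun p hp => (hn p hp).ne'
    exact continuous_eval.comp_continuousOn (hc.prodMk ht)
  have hv₂ : ContinuousOn v₂ S₂ := by
    refine hφ.comp (ContinuousOn.smul (ContinuousOn.inv₀ (by fun_prop) fun p _ => (hpos _).ne')
      continuous_fst.continuousOn) hball
  let v : (J → ℝ) × I → Y := fun p => if p ∈ S₁ then v₁ p else v₂ p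
  have hv₁' : EqOn v v₁ S₁ := fun p hp => if_pos hp
  have hv₂' : EqOn v v₂ S₂ := by
    intro p hp
    by_cases h : p ∈ S₁
    · have he : ‖p.1‖ = 1 - (p.2 : ℝ) / 2 := le_antisymm hp.2 h.2
      have hτ : τ p = 0 := by
        have : 2 - (2 - (p.2 : ℝ)) / ‖p.1‖ = 0 := by
          have := (hn p h).ne'
          rw [sub_eq_zero, eq_div_iff this, he]
          ring
        simp only [τ, this]
        exact projIcc_left _
      rw [hv₁' h]
      simp only [v₁, v₂, hτ, ← he]
      exact hg0 _ (hsph p h)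
    · exact if_neg h
  have hcover : ∀ b ∈ closedBall (0 : J → ℝ) 1, ∀ t : I, (b, t) ∈ S₁ ∨ (b, t) ∈ S₂ := by
    intro b hb t
    rw [mem_closedBall_zero_iff] at hb
    rcases le_total (1 - (t : ℝ) / 2) ‖b‖ with h | h
    · exact Or.inl ⟨hb, h⟩
    · exact Or.inr ⟨hb, h⟩
  have hv : ContinuousOn v (S₁ ∪ S₂) :=
    (hv₁.congr hv₁').union_of_isClosed (hv₂.congr hv₂') hS₁ hS₂
  let F : C(closedBall (0 : J → ℝ) 1 × I, Y) :=
    ⟨fun p => v (p.1.1, p.2), hv.comp_continuous (by fun_prop) fun p => hcover _ p.1.2 p.2⟩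
  have hF1 : ∀ b (hb : b ∈ closedBall (0 : J → ℝ) 1) (t : I), (b, t) ∈ S₁ →
      F.curry ⟨b, hb⟩ t = v₁ (b, t) := fun b hb t h => hv₁' h
  have hF2 : ∀ b (hb : b ∈ closedBall (0 : J → ℝ) 1) (t : I), (b, t) ∈ S₂ →
      F.curry ⟨b, hb⟩ t = v₂ (b, t) := fun b hb t h => hv₂' h
  refine ⟨fun b => if hb : b ∈ closedBall (0 : J → ℝ) 1 then F.curry ⟨b, hb⟩ else g b,
    ?_, ?_, ?_, ?_⟩
  · rw [continuousOn_iff_continuous_domRestrict]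
    convert F.curry.continuous using 1
    funext b
    exact dif_pos b.2
  · intro b hb
    have hb' : b ∈ closedBall (0 : J → ℝ) 1 := sphere_subset_closedBall hb
    rw [mem_sphere_zero_iff_norm] at hb
    simp only [dif_pos hb']
    ext t
    rw [hF1 b hb' t ⟨hb.le, by rw [hb]; linarith [t.2.1]⟩]
    have ht : τ (b, t) = t := by
      have : 2 - (2 - (t : ℝ)) / ‖b‖ = t := by rw [hb]; ring
      simp only [τ, this]
      exact projIcc_val zero_le_one t
    simp only [v₁, ht, hb, inv_one, one_smul]
  · intro b hb
    simp only [dif_pos hb]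
    rw [hF2 b hb 0 ⟨mem_closedBall_zero_iff.1 hb, by simpa using hb⟩]
    simp [v₂]
  · intro b hb t
    simp only [dif_pos hb]
    rcases hcover b hb t with h | h
    · rw [hF1 b hb t h]; exact Or.inr ⟨_, hsph _ h, _, rfl⟩
    · rw [hF2 b hb t h]; exact Or.inl ⟨_, hball _ h, rfl⟩

namespace PtdSpace

/-- The base point has a neighbourhood `{u < 1}` that can be contracted to it within `X`. -/
def WellPointed (X : PtdSpace.{u}) : Prop :=
  ∃ (w : C(X, I)) (H : C(X × I, X)), w X.pt = 0 ∧ (∀ x, H (x, 0) = x) ∧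
    (∀ t, H (X.pt, t) = X.pt) ∧ ∀ x, w x ≠ 1 → H (x, 1) = X.pt

/-- Homotopy extension over the cells gives a retraction of `X × I` onto `X × 0 ∪ * × I`, encoded as
paths. Its first coordinate is the contraction, and one minus its height at time `1` is `w`:
positive height forces the first coordinate to be the base point. -/
theorem IsCW.wellPointed {X : PtdSpace.{u}} (hX : X.IsCW) : X.WellPointed := by
  obtain ⟨_, C, v, hv, hvb⟩ := (isCW_iff _).1 hX
  let P : ∀ i, ((C.J i → ℝ) → C(I, X × I)) → Prop := fun i h =>
    ∀ b ∈ closedBall 0 1, h b 0 = (C.Φ i b, 0) ∧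
      (∀ t, (h b t).1 = X.pt ∨ (h b t).2 = 0) ∧ (C.Φ i b = X.pt → ∀ t, h b t = (X.pt, t))
  have : Nonempty C(I, X × I) := ⟨⟨fun t => (X.pt, t), by fun_prop⟩⟩
  obtain ⟨f, hf⟩ := C.exists_continuous_of_cells P
    (fun i h h' hh hp b hb => by rw [← hh hb]; exact hp b hb)
    (fun i g hg hc => by
      -- The vertex has no boundary to extend from, and its path is prescribed. No other open cell
      -- contains the base point.
      by_cases hi : i = v
      · subst hi
        let h₀ : C(I, X × I) := ⟨fun t => (X.pt, t), by fun_prop⟩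
        refine ⟨fun _ => h₀, continuousOn_const, fun b hb => ?_, fun b hb => ⟨?_, ?_, ?_⟩⟩
        · exact absurd (mem_sphere.1 hb) (by simp [Subsingleton.elim b 0])
        · rw [hvb]; rfl
        · exact fun t => Or.inl rfl
        · exact fun _ t => rfl
      · have hgs : ∀ b ∈ sphere (0 : C.J i → ℝ) 1, g (C.Φ i b) 0 = (C.Φ i b, 0) ∧
            (∀ t, (g (C.Φ i b) t).1 = X.pt ∨ (g (C.Φ i b) t).2 = 0) ∧
            (C.Φ i b = X.pt → ∀ t, g (C.Φ i b) t = (X.pt, t)) := by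
          intro b hb
          obtain ⟨F, -, hF, hs⟩ := C.frontier i
          obtain ⟨j, hj, c, hc, hcb⟩ := hs b hb
          rw [← hcb]
          exact (hg j (hF j hj)).2 c hc
        obtain ⟨h, h1, h2, h3, h4⟩ := exists_homotopy_extension_closedBall
          (fun b => (C.Φ i b, (0 : I))) ((C.cont i).prodMk continuousOn_const) (g ∘ C.Φ i) hc
          fun b hb => (hgs b hb).1
        refine ⟨h, h1, h2, fun b hb => ⟨h3 b hb, fun t => ?_, fun hb' t => ?_⟩⟩
        · rcases h4 b hb t with ⟨b', -, h5⟩ | ⟨b', hb', t', h5⟩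
          · rw [h5]; exact Or.inr rfl
          · rw [h5]; exact (hgs b' hb').2.1 t'
        · rcases (mem_closedBall.1 hb).lt_or_eq with hlt | heq
          · refine absurd (C.disj i v b (mem_ball.2 hlt) 0 (mem_ball_self one_pos) ?_) hi
            rw [hb', hvb]
          · rw [h2 (mem_sphere.2 heq)]
            exact (hgs b (mem_sphere.2 heq)).2.2 hb' t)
  have hfx : ∀ x, f x 0 = (x, 0) ∧ (∀ t, (f x t).1 = X.pt ∨ (f x t).2 = 0) ∧
      (x = X.pt → ∀ t, f x t = (X.pt, t)) := by
    intro x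
    have := hf (C.idx x) (C.coord x) (ball_subset_closedBall (C.coord_mem x))
    simpa only [Function.comp, C.map_coord] using this
  refine ⟨⟨fun x => σ (f x 1).2, by fun_prop⟩, ⟨fun p => (f p.1 p.2).1, by fun_prop⟩, ?_, ?_, ?_, ?_⟩
  · simp [(hfx X.pt).2.2 rfl]
  · intro x; simp [(hfx x).1]
  · intro t; simp [(hfx X.pt).2.2 rfl]
  · intro x hx
    refine ((hfx x).2.1 1).resolve_right fun h => hx ?_
    simp [h]

end PtdSpace

/-! ### Compactly generated spaces and quotient maps -/

section CompactlyGenerated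

variable {W X Y Z L : Type*} [TopologicalSpace W] [TopologicalSpace X] [TopologicalSpace Y]
  [TopologicalSpace Z] [TopologicalSpace L]

/-- The range of `f` is compact, hence one of the test sets. -/
lemma isOpen_preimage_of_compactSpace {U : Set X} (hU : ∀ K, IsCompact K → IsOpen (K ↓∩ U))
    [CompactSpace L] {f : L → X} (hf : Continuous f) : IsOpen (f ⁻¹' U) := by
  have := (hU (range f) (isCompact_range hf)).preimage (hf.codRestrict mem_range_self)
  rwa [← preimage_comp] at this

lemma isQuotientMap_of_isOpen {f : X → Y} (hs : Surjective f) (hc : Continuous f)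
    (h : ∀ U, IsOpen (f ⁻¹' U) → IsOpen U) : IsQuotientMap f :=
  isQuotientMap_iff_isClosed.2 ⟨hs, fun s => ⟨fun hs => hs.preimage hc, fun hs =>
    isOpen_compl_iff.1 (h sᶜ hs.isOpen_compl)⟩⟩

/-- The product of a compactly generated space and a locally compact space is compactly
generated. -/
instance CompactlyCoherentSpace.prod_locallyCompactSpace [CompactlyCoherentSpace W]
    [LocallyCompactSpace L] : CompactlyCoherentSpace (W × L) := by
  refine .of_isOpen fun U hU => isOpen_iff_mem_nhds.2 ?_
  rintro ⟨w, t⟩ hwt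
  have hslice : IsOpen {s | (w, s) ∈ U} := by
    rw [CompactlyCoherentSpace.isOpen_iff]
    intro K hK
    have := isCompact_iff_compactSpace.1 hK
    exact isOpen_preimage_of_compactSpace (L := K) hU
      (f := fun s => (w, (s : L))) (by fun_prop)
  obtain ⟨J, hJt, hJU, hJ⟩ := local_compact_nhds (hslice.mem_nhds hwt)
  -- Tube lemma over each compact `K`: the complement is the projection, along the compact `J`, of a
  -- closed set.
  have hV : IsOpen {v | ∀ s ∈ J, (v, s) ∈ U} := by
    rw [CompactlyCoherentSpace.isOpen_iff]
    intro K hK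
    have := isCompact_iff_compactSpace.1 hK
    have := isCompact_iff_compactSpace.1 hJ
    have h1 : IsOpen {p : K × J | ((p.1 : W), (p.2 : L)) ∈ U} :=
      isOpen_preimage_of_compactSpace (L := K × J) hU
        (f := fun p => ((p.1 : W), (p.2 : L))) (by fun_prop)
    have h2 := (isClosedMap_fst_of_compactSpace (X := K) (Y := J)) _ h1.isClosed_compl
    convert h2.isOpen_compl using 1
    ext v
    simp
  exact Filter.mem_of_superset (prod_mem_nhds (hV.mem_nhds fun s hs => hJU hs) hJt)
    fun p hp => hp.1 p.2 hp.2

lemma Topology.IsQuotientMap.compactlyCoherentSpace [CompactlyCoherentSpace W] {f : W → X}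
    (hf : IsQuotientMap f) : CompactlyCoherentSpace X := by
  refine .of_isOpen fun U hU => ?_
  rw [← hf.isOpen_preimage, CompactlyCoherentSpace.isOpen_iff]
  intro K hK
  have := isCompact_iff_compactSpace.1 hK
  exact isOpen_preimage_of_compactSpace (L := K) hU
    (hf.continuous.comp continuous_subtype_val)

namespace CompactCoherentification

lemma continuous_mk_comp [CompactlyCoherentSpace W] {f : W → X} (hf : Continuous f) :
    Continuous (CompactCoherentification.mk X ∘ f) := by
  have h := (continuous_map_of_continuous hf).comp (continuous_mk (X := W))
  rwa [CompactCoherentification.map_comp_mk] at h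

/-- The compactly generated topologies of homeomorphic spaces are homeomorphic. -/
noncomputable def congr (e : X ≃ₜ Y) : 𝐤 X ≃ₜ 𝐤 Y where
  toEquiv := (CompactCoherentification.mk X).symm.trans
    (e.toEquiv.trans (CompactCoherentification.mk Y))
  continuous_toFun := show Continuous (CompactCoherentification.map e) from
    continuous_map_of_continuous e.continuous
  continuous_invFun := show Continuous (CompactCoherentification.map e.symm) from
    continuous_map_of_continuous e.symm.continuous

/-- Compactly generated products commute with quotient maps. -/
theorem isQuotientMap_map_prodMap [CompactlyCoherentSpace X] [T2Space Z] {q : X → Y}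
    (hq : IsQuotientMap q) :
    IsQuotientMap (CompactCoherentification.map (Prod.map q (id : Z → Z))) := by
  have hc : Continuous (CompactCoherentification.map (Prod.map q (id : Z → Z))) :=
    continuous_map_of_continuous (hq.continuous.prodMap continuous_id)
  have hs : Surjective (Prod.map q (id : Z → Z)) := hq.surjective.prodMap surjective_id
  refine isQuotientMap_of_isOpen hs hc fun U hU => ?_
  rw [isOpen_iff]
  intro K hK
  -- Only the part of `Z` under `K` matters. It is compact Hausdorff, so over it `q × id` is a
  -- quotient map for the ordinary product topology.
  have hK₂ : CompactSpace (Prod.snd '' K) := isCompact_iff_compactSpace.1 (hK.image continuous_snd)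
  have hq₂ : Continuous fun p : X × (Prod.snd '' K) => ((p.1, p.2.1) : X × Z) := by fun_prop
  have h1 : IsOpen {p : X × (Prod.snd '' K) |
      CompactCoherentification.mk (Y × Z) (q p.1, p.2.1) ∈ U} :=
    hU.preimage (continuous_mk_comp hq₂)
  have h2 : IsOpen {p : Y × (Prod.snd '' K) |
      CompactCoherentification.mk (Y × Z) (p.1, p.2.1) ∈ U} := by
    rw [isOpen_iff_continuous_mem] at h1 ⊢
    exact hq.continuous_lift_prod_left
      (g := fun p : Y × (Prod.snd '' K) => CompactCoherentification.mk (Y × Z) (p.1, p.2.1) ∈ U) h1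
  have h3 : Continuous fun p : K => ((p.1.1, ⟨p.1.2, p.1, p.2, rfl⟩) : Y × (Prod.snd '' K)) := by
    fun_prop
  exact h2.preimage h3

end CompactCoherentification

/-- Whitehead's theorem on quotient maps, with open sets read as continuous predicates so that
descent of continuous functions applies. -/
lemma Topology.IsQuotientMap.prodMap_id [LocallyCompactSpace L] {q : X → Y} (hq : IsQuotientMap q) :
    IsQuotientMap (Prod.map q (id : L → L)) := by
  have hc : Continuous (Prod.map q (id : L → L)) := hq.continuous.prodMap continuous_id
  refine isQuotientMap_of_isOpen (hq.surjective.prodMap surjective_id) hc fun U hU => ?_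
  rw [isOpen_iff_continuous_mem] at hU ⊢
  exact hq.continuous_lift_prod_left (g := fun p : Y × L => p ∈ U) hU

end CompactlyGenerated

/-! ### Maps and homotopies out of a quotient -/

namespace IsCollapse

variable {W P Y : Type*} [TopologicalSpace W] [TopologicalSpace P] [TopologicalSpace Y]
  {f : W → P} {N : Set W}

lemma factorsThrough (hf : IsCollapse f N) {T : Type*} {g : W → T}
    (hN : ∀ w ∈ N, ∀ w' ∈ N, g w = g w') : FactorsThrough g f := by
  intro w w' h
  rcases (hf.eq_iff w w').1 h with rfl | ⟨h₁, h₂⟩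
  · rfl
  · exact hN _ h₁ _ h₂

/-- The continuous map on the quotient induced by a map that is constant on the collapsed
subset. -/
noncomputable def desc (hf : IsCollapse f N) (g : W → Y) (hg : Continuous g)
    (hN : ∀ w ∈ N, ∀ w' ∈ N, g w = g w') : C(P, Y) :=
  hf.isQuotientMap.lift (f := ⟨f, hf.isQuotientMap.continuous⟩) ⟨g, hg⟩ (hf.factorsThrough hN)

@[simp]
lemma desc_apply (hf : IsCollapse f N) (g : W → Y) (hg : Continuous g)
    (hN : ∀ w ∈ N, ∀ w' ∈ N, g w = g w') (w : W) : hf.desc g hg hN (f w) = g w :=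
  DFunLike.congr_fun (hf.isQuotientMap.lift_comp (f := ⟨f, hf.isQuotientMap.continuous⟩) ⟨g, hg⟩
    (hf.factorsThrough hN)) w

/-- Homotopies on a quotient are induced by homotopies that are stationary on the collapsed
subset. -/
lemma homotopicRel (hf : IsCollapse f N) {n : W} (hn : n ∈ N) {α β : C(P, Y)} (F : W × I → Y)
    (hF : Continuous F) (h0 : ∀ w, F (w, 0) = α (f w)) (h1 : ∀ w, F (w, 1) = β (f w))
    (hN : ∀ w ∈ N, ∀ t, F (w, t) = α (f n)) : α.HomotopicRel β {f n} := by
  let g : P × I → Y := fun p => F (surjInv hf.isQuotientMap.surjective p.1, p.2)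
  have hg : ∀ w t, g (f w, t) = F (w, t) := fun w t =>
    hf.factorsThrough (g := fun w => F (w, t))
      (fun w hw w' hw' => (hN w hw t).trans (hN w' hw' t).symm) (surjInv_eq _ _)
  have hgc : Continuous g :=
    hf.isQuotientMap.continuous_lift_prod_left (by simp only [hg]; exact hF)
  refine ⟨⟨⟨⟨fun p => g (p.2, p.1), by fun_prop⟩, fun p => ?_, fun p => ?_⟩, ?_⟩⟩
  · obtain ⟨w, rfl⟩ := hf.isQuotientMap.surjective p
    exact (hg w 0).trans (h0 w)
  · obtain ⟨w, rfl⟩ := hf.isQuotientMap.surjective p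
    exact (hg w 1).trans (h1 w)
  · rintro t _ rfl
    exact (hg n t).trans (hN n hn t)

end IsCollapse

/-! ### Based homotopy equivalences and their functoriality -/

namespace PtdSpace

theorem HtpyEquiv.refl (X : PtdSpace.{u}) : HtpyEquiv X X :=
  ⟨.id _, .id _, rfl, rfl, .refl _, .refl _⟩

theorem HtpyEquiv.symm {X Y : PtdSpace.{u}} (h : HtpyEquiv X Y) : HtpyEquiv Y X := by
  obtain ⟨f, g, hf, hg, h1, h2⟩ := h
  exact ⟨g, f, hg, hf, h2, h1⟩

lemma HomotopicRel.comp_right {A B C : Type*} [TopologicalSpace A] [TopologicalSpace B]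
    [TopologicalSpace C] {f g : C(B, C)} {S : Set B} (h : f.HomotopicRel g S) (k : C(A, B))
    {T : Set A} (hk : MapsTo k T S) : (f.comp k).HomotopicRel (g.comp k) T := by
  obtain ⟨F⟩ := h
  refine ⟨⟨⟨⟨fun p => F (p.1, k p.2), by fun_prop⟩, fun a => ?_, fun a => ?_⟩, ?_⟩⟩
  · exact F.apply_zero _
  · exact F.apply_one _
  · intro t a ha
    exact F.eq_fst t (hk ha)

lemma homotopicRel_of_comp {X Y Z : PtdSpace.{u}} {f : C(X, Y)} {f' : C(Y, X)} {g : C(Y, Z)}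
    {g' : C(Z, Y)} (hf : f X.pt = Y.pt) (h : (f'.comp f).HomotopicRel (.id X) {X.pt})
    (h' : (g'.comp g).HomotopicRel (.id Y) {Y.pt}) :
    ((f'.comp g').comp (g.comp f)).HomotopicRel (.id X) {X.pt} := by
  refine .trans ?_ h
  have h1 := (HomotopicRel.comp_right h' f (T := {X.pt}) (by rintro _ rfl; exact hf))
  exact h1.comp_continuousMap f'

theorem HtpyEquiv.trans {X Y Z : PtdSpace.{u}} (h : HtpyEquiv X Y) (h' : HtpyEquiv Y Z) :
    HtpyEquiv X Z := by
  obtain ⟨f, f', hf, hf', h1, h2⟩ := h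
  obtain ⟨g, g', hg, hg', h3, h4⟩ := h'
  exact ⟨g.comp f, f'.comp g', by simp [hf, hg], by simp [hf', hg'], homotopicRel_of_comp hf h1 h3,
    homotopicRel_of_comp hg' h4 h2⟩

theorem HtpyEquiv.of_homeomorph {X Y : PtdSpace.{u}} (e : X ≃ₜ Y) (he : e X.pt = Y.pt) :
    HtpyEquiv X Y := by
  refine ⟨e, e.symm, he, by simp [← he], ?_, ?_⟩
  · convert ContinuousMap.HomotopicRel.refl _
    ext; simp
  · convert ContinuousMap.HomotopicRel.refl _
    ext; simp

/-- Two collapses of the same subset are homotopy equivalent. -/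
theorem HtpyEquiv.of_isCollapse {W : Type*} [TopologicalSpace W] {N : Set W} {X Y : PtdSpace.{u}}
    {f : W → X} {g : W → Y} (hf : IsCollapse f N) (hg : IsCollapse g N) {n : W} (hfn : f n = X.pt)
    (hgn : g n = Y.pt) : HtpyEquiv X Y := by
  obtain ⟨e, he⟩ := hf.exists_homeomorph hg
  exact .of_homeomorph e (by rw [← hfn, he, hgn])

section Collapse

variable {Z Z' : Type u} [TopologicalSpace Z] [TopologicalSpace Z']
  {A' : Set Z'} {a' : Z'} {A : Set Z} {a : Z}

/-- The map of quotients induced by a map of pairs. -/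
noncomputable def collapseMap (ha' : a' ∈ A') (f : C(Z, Z')) (hf : MapsTo f A A') :
    C(collapse Z A a, collapse Z' A' a') :=
  (isCollapse_collapseMk A a).desc (fun z => collapseMk A' a' (f z))
    ((isCollapse_collapseMk A' a').isQuotientMap.continuous.comp f.continuous)
    fun w hw w' hw' => by rw [collapseMk_eq_pt ha' (hf hw), collapseMk_eq_pt ha' (hf hw')]

@[simp]
lemma collapseMap_mk (ha' : a' ∈ A') (f : C(Z, Z')) (hf : MapsTo f A A') (z : Z) :
    collapseMap (a := a) ha' f hf (collapseMk A a z) = collapseMk A' a' (f z) :=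
  IsCollapse.desc_apply _ _ _ _ _

lemma collapseMap_homotopicRel (ha : a ∈ A) (ha' : a' ∈ A') {f : C(Z, Z')} (hf : MapsTo f A A')
    {g : C(Z', Z)} (hg : MapsTo g A' A) (F : Z × I → Z) (hF : Continuous F)
    (h0 : ∀ z, F (z, 0) = g (f z)) (h1 : ∀ z, F (z, 1) = z) (hA : ∀ z ∈ A, ∀ t, F (z, t) ∈ A) :
    ((collapseMap ha g hg).comp (collapseMap (a := a) ha' f hf)).HomotopicRel (.id _)
      {(collapse Z A a).pt} := by
  have hc := isCollapse_collapseMk A a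
  refine hc.homotopicRel ha (fun p => collapseMk A a (F p)) (hc.isQuotientMap.continuous.comp hF)
    (fun z => ?_) (fun z => ?_) fun z hz t => ?_
  · simp [h0]
  · simp [h1]
  · simp only [ContinuousMap.comp_apply, collapseMap_mk]
    rw [collapseMk_eq_pt ha (hA z hz t), collapseMk_eq_pt ha (hg (hf ha))]

/-- A homotopy equivalence of pairs induces a homotopy equivalence of quotients. -/
theorem HtpyEquiv.collapse (ha : a ∈ A) (ha' : a' ∈ A') (f : C(Z, Z')) (hf : MapsTo f A A')
    (g : C(Z', Z)) (hg : MapsTo g A' A)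
    (F : Z × I → Z) (hF : Continuous F)
    (h0 : ∀ z, F (z, 0) = g (f z)) (h1 : ∀ z, F (z, 1) = z) (hA : ∀ z ∈ A, ∀ t, F (z, t) ∈ A)
    (F' : Z' × I → Z') (hF' : Continuous F')
    (h0' : ∀ z, F' (z, 0) = f (g z)) (h1' : ∀ z, F' (z, 1) = z)
    (hA' : ∀ z ∈ A', ∀ t, F' (z, t) ∈ A') :
    HtpyEquiv (PtdSpace.collapse Z A a) (PtdSpace.collapse Z' A' a') :=
  ⟨collapseMap ha' f hf, collapseMap ha g hg,
    (collapseMap_mk ha' f hf a).trans (collapseMk_eq_pt ha' (hf ha)),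
    (collapseMap_mk ha g hg a').trans (collapseMk_eq_pt ha (hg ha')),
    collapseMap_homotopicRel ha ha' hf hg F hF h0 h1 hA,
    collapseMap_homotopicRel ha' ha hg hf F' hF' h0' h1' hA'⟩

end Collapse

/-- A homotopy equivalence of based spaces given by explicit homotopies. -/
theorem HtpyEquiv.exists_homotopies {X Y : PtdSpace.{u}} (h : HtpyEquiv X Y) :
    ∃ (f : C(X, Y)) (g : C(Y, X)) (F : C(X × I, X)) (G : C(Y × I, Y)),
      f X.pt = Y.pt ∧ g Y.pt = X.pt ∧
      (∀ x, F (x, 0) = g (f x)) ∧ (∀ x, F (x, 1) = x) ∧ (∀ t, F (X.pt, t) = X.pt) ∧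
      (∀ y, G (y, 0) = f (g y)) ∧ (∀ y, G (y, 1) = y) ∧ (∀ t, G (Y.pt, t) = Y.pt) := by
  obtain ⟨f, g, hf, hg, ⟨F⟩, ⟨G⟩⟩ := h
  refine ⟨f, g, ⟨fun p => F (p.2, p.1), by fun_prop⟩, ⟨fun p => G (p.2, p.1), by fun_prop⟩, hf, hg,
    fun x => F.apply_zero x, fun x => F.apply_one x, fun t => ?_,
    fun x => G.apply_zero x, fun x => G.apply_one x, fun t => ?_⟩
  · exact (F.eq_snd t rfl)
  · exact (G.eq_snd t rfl)

theorem HtpyEquiv.susp {X Y : PtdSpace.{u}} (h : HtpyEquiv X Y) : HtpyEquiv (susp X) (susp Y) := by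
  obtain ⟨f, g, F, G, hf, hg, F0, F1, Fpt, G0, G1, Gpt⟩ := h.exists_homotopies
  refine .collapse (Or.inl rfl) (Or.inl rfl) (f.prodMap (.id I)) ?_ (g.prodMap (.id I)) ?_
    (fun p => (F (p.1.1, p.2), p.1.2)) (by fun_prop) ?_ ?_ ?_
    (fun p => (G (p.1.1, p.2), p.1.2)) (by fun_prop) ?_ ?_ ?_
  · rintro p (h | h | h)
    exacts [Or.inl h, Or.inr (Or.inl h), Or.inr (Or.inr (by simp [h, hf]))]
  · rintro p (h | h | h)
    exacts [Or.inl h, Or.inr (Or.inl h), Or.inr (Or.inr (by simp [h, hg]))]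
  · intro p; simp [F0, Prod.map]
  · intro p; simp [F1]
  · rintro p (h | h | h) t
    exacts [Or.inl h, Or.inr (Or.inl h), Or.inr (Or.inr (by simp [h, Fpt]))]
  · intro p; simp [G0, Prod.map]
  · intro p; simp [G1]
  · rintro p (h | h | h) t
    exacts [Or.inl h, Or.inr (Or.inl h), Or.inr (Or.inr (by simp [h, Gpt]))]

theorem HtpyEquiv.susp_iterate {X Y : PtdSpace.{u}} (h : HtpyEquiv X Y) (n : ℕ) :
    HtpyEquiv (PtdSpace.susp^[n] X) (PtdSpace.susp^[n] Y) := by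
  induction n with
  | zero => exact h
  | succ n ih =>
    rw [iterate_succ_apply', iterate_succ_apply']
    exact ih.susp

theorem HtpyEquiv.wedge {κ : Type} [Nonempty κ] {X Y : κ → PtdSpace.{u}}
    (h : ∀ k, HtpyEquiv (X k) (Y k)) : HtpyEquiv (wedge X) (wedge Y) := by
  choose f g F G hf hg F0 F1 Fpt G0 G1 Gpt using fun k => (h k).exists_homotopies
  have key : ∀ {V : κ → PtdSpace.{u}} (H : ∀ k, C(V k × I, V k)),
      Continuous fun p : (Σ k, V k) × I => (⟨p.1.1, H p.1.1 (p.1.2, p.2)⟩ : Σ k, V k) := by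
    intro V H
    have h1 : Continuous fun p : Σ k, V k × I => (⟨p.1, H p.1 p.2⟩ : Σ k, V k) :=
      continuous_sigma fun k => continuous_sigmaMk.comp (H k).continuous
    exact h1.comp (Homeomorph.sigmaProdDistrib (X := fun k => (V k : Type u)) (Y := I)).continuous
  refine .collapse (by rfl) (by rfl)
    ⟨Sigma.map id fun k => f k, Continuous.sigma_map fun k => (f k).continuous⟩ ?_
    ⟨Sigma.map id fun k => g k, Continuous.sigma_map fun k => (g k).continuous⟩ ?_
    _ (key F) ?_ ?_ ?_ _ (key G) ?_ ?_ ?_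
  · rintro ⟨k, x⟩ (h : x = (X k).pt); subst h; exact hf k
  · rintro ⟨k, x⟩ (h : x = (Y k).pt); subst h; exact hg k
  · rintro ⟨k, x⟩; simp [F0, Sigma.map]
  · rintro ⟨k, x⟩; simp [F1]
  · rintro ⟨k, x⟩ (h : x = (X k).pt) t; subst h; exact Fpt k t
  · rintro ⟨k, x⟩; simp [G0, Sigma.map]
  · rintro ⟨k, x⟩; simp [G1]
  · rintro ⟨k, x⟩ (h : x = (Y k).pt) t; subst h; exact Gpt k t

end PtdSpace

/-! ### Suspensions of wedges -/

lemma isQuotientMap_sigmaMap {κ : Type*} {X Y : κ → Type*} [∀ k, TopologicalSpace (X k)]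
    [∀ k, TopologicalSpace (Y k)] {f : ∀ k, X k → Y k} (hf : ∀ k, IsQuotientMap (f k)) :
    IsQuotientMap (Sigma.map id f) := by
  refine isQuotientMap_of_isOpen (surjective_id.sigma_map fun k => (hf k).surjective)
    (Continuous.sigma_map fun k => (hf k).continuous) fun U hU => ?_
  rw [isOpen_sigma_iff] at hU ⊢
  exact fun k => (hf k).isOpen_preimage.1 (hU k)

/-- The product of a family indexed by `Fin (k + 1)` as a binary product. -/
def Homeomorph.piFinSucc {k : ℕ} (X : Fin (k + 1) → Type*) [∀ i, TopologicalSpace (X i)] :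
    (∀ i, X i) ≃ₜ X 0 × ∀ i : Fin k, X i.succ where
  toFun p := (p 0, fun i => p i.succ)
  invFun q := Fin.cons q.1 q.2
  left_inv p := by
    funext i
    refine Fin.cases ?_ (fun i => ?_) i <;> rfl
  right_inv q := rfl
  continuous_toFun := by fun_prop
  continuous_invFun := continuous_pi fun i => by
    refine Fin.cases ?_ (fun i => ?_) i
    · exact continuous_fst
    · exact (continuous_apply i).comp continuous_snd

namespace PtdSpace

lemma collapseMk_eq_pt_iff {Z : Type u} [TopologicalSpace Z] {A : Set Z} {a : Z} (ha : a ∈ A)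
    {z : Z} : collapseMk A a z = (collapse Z A a).pt ↔ z ∈ A :=
  ⟨fun h => ((isCollapse_collapseMk A a).mem_iff h).2 ha, collapseMk_eq_pt ha⟩

lemma collapseMk_eq_iff {Z : Type u} [TopologicalSpace Z] {A : Set Z} {a : Z} (ha : a ∈ A)
    {z z' : Z} : collapseMk A a z = collapseMk A a z' ↔ z = z' ∨
      (collapseMk A a z = (collapse Z A a).pt ∧ collapseMk A a z' = (collapse Z A a).pt) := by
  rw [(isCollapse_collapseMk A a).eq_iff, collapseMk_eq_pt_iff ha, collapseMk_eq_pt_iff ha]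

/-- The set collapsed in the definition of the suspension. -/
def suspSet (X : PtdSpace.{u}) : Set (X × I) := {p | p.2 = 0 ∨ p.2 = 1 ∨ p.1 = X.pt}

/-- The projection from the cylinder to the suspension. -/
def suspMk (X : PtdSpace.{u}) (p : X × I) : susp X := collapseMk X.suspSet (X.pt, 0) p

lemma isCollapse_suspMk (X : PtdSpace.{u}) : IsCollapse X.suspMk X.suspSet :=
  isCollapse_collapseMk _ _

lemma suspMk_eq_pt_iff {X : PtdSpace.{u}} {p : X × I} :
    X.suspMk p = (susp X).pt ↔ p.2 = 0 ∨ p.2 = 1 ∨ p.1 = X.pt :=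
  collapseMk_eq_pt_iff (A := X.suspSet) (Or.inl rfl)

lemma suspMk_eq_iff {X : PtdSpace.{u}} {p q : X × I} : X.suspMk p = X.suspMk q ↔
    p = q ∨ (X.suspMk p = (susp X).pt ∧ X.suspMk q = (susp X).pt) :=
  collapseMk_eq_iff (A := X.suspSet) (Or.inl rfl)

@[fun_prop]
lemma continuous_suspMk (X : PtdSpace.{u}) : Continuous X.suspMk :=
  X.isCollapse_suspMk.isQuotientMap.continuous

/-- The suspension of a quotient is a quotient of the cylinder. -/
lemma isCollapse_suspMk_comp {Z : Type*} [TopologicalSpace Z] {C : PtdSpace.{u}} {N : Set Z}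
    {p : Z → C} (hp : IsCollapse p N) {n : Z} (hn : n ∈ N) (hpn : p n = C.pt) :
    IsCollapse (fun q : Z × I => C.suspMk (p q.1, q.2)) {q | q.2 = 0 ∨ q.2 = 1 ∨ q.1 ∈ N} := by
  have hiff : ∀ z, p z = C.pt ↔ z ∈ N := fun z =>
    ⟨fun h => (hp.mem_iff (h.trans hpn.symm)).2 hn, fun h => (hp.eq_of_mem h hn).trans hpn⟩
  have h := IsCollapse.comp hp.isQuotientMap.prodMap_id C.isCollapse_suspMk ?_
  · convert! h using 1
    ext q
    simp [suspSet, hiff]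
  · rintro ⟨z, t⟩ ⟨z', t'⟩ h
    obtain ⟨h1, rfl : t = t'⟩ := Prod.ext_iff.1 h
    rcases (hp.eq_iff _ _).1 h1 with rfl | ⟨h1, h2⟩
    · exact Or.inl rfl
    · exact Or.inr ⟨Or.inr (Or.inr ((hiff _).2 h1)), Or.inr (Or.inr ((hiff _).2 h2))⟩

/-- Suspension commutes with wedges. -/
theorem susp_wedge {κ : Type} [Nonempty κ] (X : κ → PtdSpace.{u}) :
    HtpyEquiv (susp (wedge X)) (wedge fun k => susp (X k)) := by
  have h1 : IsCollapse _ _ := isCollapse_suspMk_comp (C := wedge X)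
    (isCollapse_collapseMk (Z := Σ k, X k) {p | p.2 = (X p.1).pt} _) (by rfl) rfl
  -- Both sides are quotients of one space, a disjoint union of cylinders, by one subset: the
  -- cylinder coordinate is distributed over the summands.
  let q : (Σ k, X k × I) → Σ k, susp (X k) := Sigma.map id fun k => (X k).suspMk
  have hq : IsQuotientMap q :=
    isQuotientMap_sigmaMap fun k => (X k).isCollapse_suspMk.isQuotientMap
  let B : Set (Σ k, susp (X k)) := {p | p.2 = (susp (X p.1)).pt}
  let b : Σ k, susp (X k) := ⟨Classical.arbitrary κ, (susp (X (Classical.arbitrary κ))).pt⟩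
  have h2 : IsCollapse (collapseMk B b ∘ q) (q ⁻¹' B) := by
    refine IsCollapse.comp hq (isCollapse_collapseMk B b) ?_
    rintro ⟨k, p⟩ ⟨l, p'⟩ h
    obtain rfl : k = l := congrArg Sigma.fst h
    have h' : (X k).suspMk p = (X k).suspMk p' := eq_of_heq (Sigma.mk.inj h).2
    rcases suspMk_eq_iff.1 h' with rfl | h'
    · exact Or.inl rfl
    · exact Or.inr h'
  have h3 := h2.comp_homeomorph
    (Homeomorph.sigmaProdDistrib (X := fun k => (X k : Type u)) (Y := I))
  have hN : Homeomorph.sigmaProdDistrib (X := fun k => (X k : Type u)) (Y := I) ⁻¹' (q ⁻¹' B) =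
      {p | p.2 = 0 ∨ p.2 = 1 ∨ p.1 ∈ {p : Σ k, X k | p.2 = (X p.1).pt}} := by
    ext ⟨⟨k, x⟩, t⟩
    exact suspMk_eq_pt_iff
  rw [hN] at h3
  refine .of_isCollapse h1 h3
    (n := (⟨Classical.arbitrary κ, (X (Classical.arbitrary κ)).pt⟩, 0)) ?_ ?_
  · exact suspMk_eq_pt_iff.2 (Or.inl rfl)
  · refine (collapseMk_eq_pt_iff (A := B) (a := b) rfl).2 ?_
    exact suspMk_eq_pt_iff.2 (Or.inl rfl)

theorem susp_iterate_wedge {κ : Type} [Nonempty κ] (X : κ → PtdSpace.{u}) (n : ℕ) :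
    HtpyEquiv (susp^[n] (wedge X)) (wedge fun k => susp^[n] (X k)) := by
  induction n with
  | zero => exact .refl _
  | succ n ih =>
    simp only [iterate_succ_apply']
    exact ih.susp.trans (susp_wedge _)

/-- The wedge of chosen desuspensions works, since iterated suspension commutes with wedges on both
sides. -/
theorem IsSnS.wedge {n : ℕ} {κ : Type} [Nonempty κ] {X : κ → PtdSpace.{u}}
    (h : ∀ k, IsSnS n (X k)) : IsSnS n (wedge X) := by
  choose hX Y hY hXY using h
  exact ⟨.wedge hX, PtdSpace.wedge Y, .wedge hY, (susp_iterate_wedge X n).trans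
    ((HtpyEquiv.wedge hXY).trans (susp_iterate_wedge Y (n + 1)).symm)⟩

/-! ### Smashing with a pair, and smash products -/

section SmashWith

variable {Z : Type u}

/-- The set collapsed in `smashWith`. -/
def smashWithSet (X : PtdSpace.{u}) (B : Set Z) : Set (𝐤 (X × Z)) :=
  {p | ((CompactCoherentification.mk _).symm p).1 = X.pt ∨
    ((CompactCoherentification.mk _).symm p).2 ∈ B}

lemma pt_mem_smashWithSet (X : PtdSpace.{u}) (B : Set Z) (z : Z) :
    CompactCoherentification.mk _ (X.pt, z) ∈ X.smashWithSet B := Or.inl rfl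

variable [TopologicalSpace Z]

/-- The quotient of `X × Z` by `* × Z ∪ X × B`. -/
noncomputable def smashWith (X : PtdSpace.{u}) (B : Set Z) (z : Z) : PtdSpace.{u} :=
  collapse (𝐤 (X × Z)) (X.smashWithSet B) (CompactCoherentification.mk _ (X.pt, z))

/-- The homotopies act on the first coordinate. They are continuous into the finer topology because
a compactly generated space times `I` is again compactly generated. -/
theorem HtpyEquiv.smashWith {X Y : PtdSpace.{u}} (h : HtpyEquiv X Y) (B : Set Z) (z : Z) :
    HtpyEquiv (smashWith X B z) (smashWith Y B z) := by
  obtain ⟨f, g, F, G, hf, hg, F0, F1, Fpt, G0, G1, Gpt⟩ := h.exists_homotopies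
  have key : ∀ {V : PtdSpace.{u}} (H : C(V × I, V)), Continuous fun p : 𝐤 (V × Z) × I =>
      CompactCoherentification.mk (V × Z) (H (((CompactCoherentification.mk _).symm p.1).1, p.2),
        ((CompactCoherentification.mk _).symm p.1).2) := by
    intro V H
    have h1 : Continuous fun p : 𝐤 (V × Z) × I => (CompactCoherentification.mk _).symm p.1 :=
      CompactCoherentification.continuous_mk_symm.comp continuous_fst
    refine CompactCoherentification.continuous_mk_comp ?_
    exact (H.continuous.comp (h1.fst.prodMk continuous_snd)).prodMk h1.snd
  refine .collapse (pt_mem_smashWithSet X B z) (pt_mem_smashWithSet Y B z)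
    ⟨_, CompactCoherentification.continuous_map_of_continuous (f.continuous.prodMap continuous_id)⟩
    ?_
    ⟨_, CompactCoherentification.continuous_map_of_continuous (g.continuous.prodMap continuous_id)⟩
    ?_ _ (key F) ?_ ?_ ?_ _ (key G) ?_ ?_ ?_
  · rintro p (h | h)
    exacts [Or.inl ((congrArg f h).trans hf), Or.inr h]
  · rintro p (h | h)
    exacts [Or.inl ((congrArg g h).trans hg), Or.inr h]
  · exact fun p => congrArg (CompactCoherentification.mk _) (Prod.ext (F0 _) rfl)
  · exact fun p => congrArg (CompactCoherentification.mk _) (Prod.ext (F1 _) rfl)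
  · rintro p (h | h) t
    exacts [Or.inl ((congrArg (fun x => F (x, t)) h).trans (Fpt t)), Or.inr h]
  · exact fun p => congrArg (CompactCoherentification.mk _) (Prod.ext (G0 _) rfl)
  · exact fun p => congrArg (CompactCoherentification.mk _) (Prod.ext (G1 _) rfl)
  · rintro p (h | h) t
    exacts [Or.inl ((congrArg (fun x => G (x, t)) h).trans (Gpt t)), Or.inr h]

/-- Exchange of factors in compactly generated products with the interval. -/
noncomputable def prodIntervalHomeomorph (X : PtdSpace.{u}) :
    𝐤 (X × Z) × I ≃ₜ 𝐤 ((X × I) × Z) where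
  toFun p := CompactCoherentification.mk _ ((((CompactCoherentification.mk _).symm p.1).1, p.2),
    ((CompactCoherentification.mk _).symm p.1).2)
  invFun p := (CompactCoherentification.mk _ (((CompactCoherentification.mk _).symm p).1.1,
    ((CompactCoherentification.mk _).symm p).2), ((CompactCoherentification.mk _).symm p).1.2)
  left_inv _ := rfl
  right_inv _ := rfl
  continuous_toFun := by
    have h1 : Continuous fun p : 𝐤 (X × Z) × I => (CompactCoherentification.mk _).symm p.1 :=
      CompactCoherentification.continuous_mk_symm.comp continuous_fst
    exact CompactCoherentification.continuous_mk_comp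
      ((h1.fst.prodMk continuous_snd).prodMk h1.snd)
  continuous_invFun := by
    have h1 : Continuous (CompactCoherentification.mk ((X × I) × Z)).symm :=
      CompactCoherentification.continuous_mk_symm
    exact (CompactCoherentification.continuous_mk_comp (h1.fst.fst.prodMk h1.snd)).prodMk h1.fst.snd

/-- Suspension commutes with `smashWith`. -/
theorem susp_smashWith [T2Space Z] (X : PtdSpace.{u}) [CompactlyCoherentSpace X] (B : Set Z)
    (z : Z) : HtpyEquiv (susp (smashWith X B z)) (smashWith (susp X) B z) := by
  have h1 := isCollapse_suspMk_comp (C := smashWith X B z) (isCollapse_collapseMk _ _)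
    (pt_mem_smashWithSet X B z) rfl
  -- Both sides become collapses of the same subset of `𝐤 ((X × I) × Z)`, because the projection to
  -- `susp X` stays a quotient map after the compactly generated product with `Z`.
  have hq := CompactCoherentification.isQuotientMap_map_prodMap (Z := Z)
    X.isCollapse_suspMk.isQuotientMap
  have h2 := IsCollapse.comp hq (isCollapse_collapseMk ((susp X).smashWithSet B)
    (CompactCoherentification.mk _ ((susp X).pt, z))) ?_
  · have h3 := h2.comp_homeomorph (prodIntervalHomeomorph X)
    have hN : prodIntervalHomeomorph X ⁻¹' (CompactCoherentification.map
        (Prod.map X.suspMk id) ⁻¹' (susp X).smashWithSet B) =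
        {p | p.2 = 0 ∨ p.2 = 1 ∨ p.1 ∈ X.smashWithSet B} := by
      ext p
      refine (or_congr_left suspMk_eq_pt_iff).trans ?_
      simp only [or_assoc]
      rfl
    rw [hN] at h3
    refine .of_isCollapse h1 h3 (n := (CompactCoherentification.mk _ (X.pt, z), 0)) ?_ ?_
    · exact suspMk_eq_pt_iff.2 (Or.inl rfl)
    · refine (collapseMk_eq_pt_iff (pt_mem_smashWithSet (susp X) B z)).2 (Or.inl ?_)
      exact suspMk_eq_pt_iff.2 (Or.inl rfl)
  · intro p p' h
    have h := (CompactCoherentification.mk _).injective h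
    obtain ⟨h1, h2⟩ := Prod.ext_iff.1 h
    rcases suspMk_eq_iff.1 h1 with h1 | ⟨h1, h1'⟩
    · exact Or.inl ((CompactCoherentification.mk _).symm.injective (Prod.ext h1 h2))
    · exact Or.inr ⟨Or.inl h1, Or.inl h1'⟩

instance compactlyCoherentSpace_susp (X : PtdSpace.{u}) [CompactlyCoherentSpace X] :
    CompactlyCoherentSpace (susp X) :=
  X.isCollapse_suspMk.isQuotientMap.compactlyCoherentSpace

lemma compactlyCoherentSpace_susp_iterate (X : PtdSpace.{u}) [h : CompactlyCoherentSpace X]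
    (n : ℕ) : CompactlyCoherentSpace (susp^[n] X) := by
  induction n with
  | zero => exact h
  | succ n ih => rw [iterate_succ_apply']; infer_instance

theorem susp_iterate_smashWith [T2Space Z] (X : PtdSpace.{u}) [CompactlyCoherentSpace X]
    (B : Set Z) (z : Z) (n : ℕ) :
    HtpyEquiv (susp^[n] (smashWith X B z)) (smashWith (susp^[n] X) B z) := by
  induction n with
  | zero => exact .refl _
  | succ n ih =>
    have := compactlyCoherentSpace_susp_iterate X n
    simp only [iterate_succ_apply']
    exact ih.susp.trans (susp_smashWith _ _ _)

lemma IsCW.compactlyCoherentSpace {X : PtdSpace.{u}} (h : X.IsCW) : CompactlyCoherentSpace X := by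
  obtain ⟨_, C, -⟩ := (isCW_iff _).1 h
  exact C.compactlyCoherentSpace

/-- Move the suspensions into the first factor, apply `h` there, and move them out again. The two
exponents are independent because the application takes `m = n + 1`. -/
theorem susp_iterate_smashWith_of_htpyEquiv [T2Space Z] {X Y : PtdSpace.{u}} (hX : X.IsCW)
    (hY : Y.IsCW) {n m : ℕ} (h : HtpyEquiv (susp^[n] X) (susp^[m] Y)) (B : Set Z) (z : Z) :
    HtpyEquiv (susp^[n] (smashWith X B z)) (susp^[m] (smashWith Y B z)) := by
  have := hX.compactlyCoherentSpace
  have := hY.compactlyCoherentSpace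
  exact (susp_iterate_smashWith X B z n).trans
    ((h.smashWith B z).trans (susp_iterate_smashWith Y B z m).symm)

end SmashWith

/-- The quotient of a product by the points with some coordinate in `S` equal to the base
point. -/
noncomputable def smashOn {κ : Type} (X : κ → PtdSpace.{u}) (S : Set κ) : PtdSpace.{u} :=
  collapse (𝐤 (∀ k, X k))
    {p | ∃ k ∈ S, (CompactCoherentification.mk (∀ k, X k)).symm p k = (X k).pt}
    (CompactCoherentification.mk _ fun k => (X k).pt)

lemma smash_eq_smashOn {κ : Type} (X : κ → PtdSpace.{u}) : smash X = smashOn X univ := by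
  simp only [smash, smashOn, mem_univ, true_and]

/-- Splitting off coordinate `0` is a homeomorphism, and `0 ∈ S` gives the collapsed set the form `*
× Z ∪ X₀ × B`. -/
theorem smashOn_htpyEquiv_smashWith {k : ℕ} (X : Fin (k + 1) → PtdSpace.{u}) {S : Set (Fin (k + 1))}
    (hS : 0 ∈ S) : HtpyEquiv (smashOn X S)
      (smashWith (X 0) {z : ∀ i : Fin k, X i.succ | ∃ i : Fin k, i.succ ∈ S ∧ z i = (X i.succ).pt}
        fun i => (X i.succ).pt) := by
  have h1 := (isCollapse_collapseMk (smashWithSet (X 0)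
    {z : ∀ i : Fin k, X i.succ | ∃ i : Fin k, i.succ ∈ S ∧ z i = (X i.succ).pt})
    (CompactCoherentification.mk _ ((X 0).pt, fun i => (X i.succ).pt))).comp_homeomorph
    (CompactCoherentification.congr (Homeomorph.piFinSucc fun i => (X i : Type u)))
  have hN : CompactCoherentification.congr (Homeomorph.piFinSucc fun i => (X i : Type u)) ⁻¹'
      (smashWithSet (X 0)
        {z : ∀ i : Fin k, X i.succ | ∃ i : Fin k, i.succ ∈ S ∧ z i = (X i.succ).pt}) =
      {p | ∃ k ∈ S, (CompactCoherentification.mk (∀ k, X k)).symm p k = (X k).pt} := by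
    ext p
    refine Iff.trans ?_ Fin.exists_fin_succ.symm
    simp only [hS, true_and]
    rfl
  rw [hN] at h1
  exact .of_isCollapse (isCollapse_collapseMk _ _) h1
    (n := CompactCoherentification.mk _ fun k => (X k).pt) rfl rfl

/-- Only one factor of a smash product has to be an `SⁿS`-space. -/
theorem IsSnS.smashOn {n k : ℕ} {X : Fin (k + 1) → PtdSpace.{u}} (h : ∀ i, (X i).IsCW)
    (h0 : IsSnS n (X 0)) {S : Set (Fin (k + 1))} (hS : 0 ∈ S) : IsSnS n (smashOn X S) := by
  obtain ⟨-, Y, hY, hXY⟩ := h0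
  -- Only the first factor is replaced, so the pair `(Z, B)` is the same for `X` and `Y'`.
  let Y' : Fin (k + 1) → PtdSpace.{u} := Fin.cons Y fun i => X i.succ
  have hY' : ∀ i, (Y' i).IsCW := Fin.cases hY fun i => h i.succ
  have : ∀ i, T2Space (X i) := fun i => (h i).1
  refine ⟨.collapse_prod h ⟨0, hS⟩, PtdSpace.smashOn Y' S, .collapse_prod hY' ⟨0, hS⟩, ?_⟩
  refine ((smashOn_htpyEquiv_smashWith X hS).susp_iterate n).trans (.trans ?_
    ((smashOn_htpyEquiv_smashWith Y' hS).symm.susp_iterate (n + 1)))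
  exact susp_iterate_smashWith_of_htpyEquiv (h 0) hY hXY _ _

/-! ### Maps out of wedges; suspension loops -/

/-- The inclusion of a summand of a wedge. -/
noncomputable def wedgeIncl {κ : Type} [Nonempty κ] (V : κ → PtdSpace.{u}) (k : κ) :
    C(V k, wedge V) :=
  ⟨fun x => collapseMk _ _ ⟨k, x⟩,
    (isCollapse_collapseMk _ _).isQuotientMap.continuous.comp continuous_sigmaMk⟩

section WedgeIncl

variable {κ : Type} [Nonempty κ] {V : κ → PtdSpace.{u}}

@[simp]
lemma wedgeIncl_pt (k : κ) : wedgeIncl V k (V k).pt = (wedge V).pt :=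
  collapseMk_eq_pt (A := {p : Σ k, V k | p.2 = (V p.1).pt}) rfl rfl

/-- The map out of a wedge defined by based maps out of its summands. -/
lemma exists_wedge_desc {Y : Type*} [TopologicalSpace Y] (y : Y) (f : ∀ k, C(V k, Y))
    (hf : ∀ k, f k (V k).pt = y) : ∃ g : C(wedge V, Y), ∀ k x, g (wedgeIncl V k x) = f k x := by
  refine ⟨(isCollapse_collapseMk _ _).desc (fun p : Σ k, V k => f p.1 p.2)
    (continuous_sigma fun k => (f k).continuous) ?_,
    fun k x => IsCollapse.desc_apply _ _ _ _ _⟩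
  rintro ⟨k, x⟩ (hx : x = (V k).pt) ⟨l, x'⟩ (hx' : x' = (V l).pt)
  subst hx hx'
  exact (hf k).trans (hf l).symm

/-- Based maps out of a wedge are homotopic if their restrictions to the summands are. -/
lemma homotopicRel_wedge {Y : Type*} [TopologicalSpace Y] {f g : C(wedge V, Y)}
    (h : ∀ k, (f.comp (wedgeIncl V k)).HomotopicRel (g.comp (wedgeIncl V k)) {(V k).pt}) :
    f.HomotopicRel g {(wedge V).pt} := by
  have F := fun k => (h k).some
  have hc : Continuous fun p : (Σ k, V k) × I => F p.1.1 (p.2, p.1.2) := by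
    have h1 : Continuous fun p : Σ k, V k × I => F p.1 (p.2.2, p.2.1) :=
      continuous_sigma fun k => (F k).continuous.comp continuous_swap
    exact h1.comp (Homeomorph.sigmaProdDistrib (X := fun k => (V k : Type u)) (Y := I)).continuous
  refine (isCollapse_collapseMk _ _).homotopicRel (by rfl) _ hc ?_ ?_ ?_
  · exact fun p => (F p.1).apply_zero p.2
  · exact fun p => (F p.1).apply_one p.2
  · rintro ⟨k, x⟩ (hx : x = (V k).pt) t
    refine ((F k).eq_fst t hx).trans ?_
    subst hx
    exact congrArg f (wedgeIncl_pt k)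

end WedgeIncl

/-- The point at height `h` of the suspension loop through `x`. -/
noncomputable def loop (X : PtdSpace.{u}) (x : X) (h : ℝ) : susp X :=
  X.suspMk (x, projIcc 0 1 zero_le_one h)

section Loop

variable {X : PtdSpace.{u}} {x : X} {h : ℝ}

lemma loop_coe (t : I) : X.loop x t = X.suspMk (x, t) := by
  rw [loop, projIcc_val]

lemma loop_of_le (hh : h ≤ 0) : X.loop x h = (susp X).pt := by
  rw [loop, projIcc_of_le_left _ hh]
  exact suspMk_eq_pt_iff.2 (Or.inl rfl)

lemma loop_of_ge (hh : 1 ≤ h) : X.loop x h = (susp X).pt := by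
  rw [loop, projIcc_of_right_le _ hh]
  exact suspMk_eq_pt_iff.2 (Or.inr (Or.inl rfl))

lemma loop_of_eq (hx : x = X.pt) : X.loop x h = (susp X).pt :=
  suspMk_eq_pt_iff.2 (Or.inr (Or.inr hx))

lemma continuous_loop {T : Type*} [TopologicalSpace T] {f : T → X} (hf : Continuous f) {g : T → ℝ}
    (hg : Continuous g) : Continuous fun t => X.loop (f t) (g t) :=
  (continuous_suspMk X).comp (hf.prodMk (continuous_projIcc.comp hg))

end Loop

/-! ### Splitting the suspension of a space with a retract -/

/-- A subspace `i : A → B` with a retraction `r` and a neighbourhood `{w < 1}` that can be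
deformed to `A` over `A`, together with the quotient `p : B → C` that collapses it. -/
structure FibrewiseRetract (A B C : PtdSpace.{u}) where
  /-- the inclusion -/
  i : C(A, B)
  /-- the retraction -/
  r : C(B, A)
  /-- the quotient map -/
  p : B → C
  /-- the distance from `A` -/
  w : C(B, I)
  /-- the deformation -/
  H : C(B × I, B)
  i_pt : i A.pt = B.pt
  r_i : ∀ a, r (i a) = a
  isCollapse : IsCollapse p (range i)
  p_pt : p B.pt = C.pt
  w_i : ∀ a, w (i a) = 0
  H_zero : ∀ b, H (b, 0) = b
  H_i : ∀ a t, H (i a, t) = i a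
  r_H : ∀ b t, r (H (b, t)) = r b
  H_one : ∀ b, w b ≠ 1 → H (b, 1) = i (r b)

namespace FibrewiseRetract

variable {A B C : PtdSpace.{u}} (D : FibrewiseRetract A B C)

lemma r_pt : D.r B.pt = A.pt := by rw [← D.i_pt, D.r_i]

lemma H_pt (t : I) : D.H (B.pt, t) = B.pt := by rw [← D.i_pt, D.H_i]

lemma continuous_p : Continuous D.p := D.isCollapse.isQuotientMap.continuous

lemma p_i (a : A) : D.p (D.i a) = C.pt := by
  rw [← D.p_pt, ← D.i_pt]
  exact D.isCollapse.eq_of_mem ⟨a, rfl⟩ ⟨A.pt, rfl⟩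

/-- The quotient map from the cylinder of `B` to the suspension of `C`. -/
def cyl (q : B × I) : susp C := C.suspMk (D.p q.1, q.2)

lemma isCollapse_cyl : IsCollapse D.cyl {q | q.2 = 0 ∨ q.2 = 1 ∨ q.1 ∈ range D.i} :=
  isCollapse_suspMk_comp D.isCollapse ⟨A.pt, rfl⟩ ((D.p_i _))

end FibrewiseRetract

/-- A pair of spaces as a family. -/
def pair (P Q : PtdSpace.{u}) (b : Bool) : PtdSpace.{u} := bif b then Q else P

/-- The first summand of a binary wedge. -/
noncomputable def inl (P Q : PtdSpace.{u}) : C(P, wedge (pair P Q)) := wedgeIncl (pair P Q) false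

/-- The second summand of a binary wedge. -/
noncomputable def inr (P Q : PtdSpace.{u}) : C(Q, wedge (pair P Q)) := wedgeIncl (pair P Q) true

@[simp] lemma inl_pt {P Q : PtdSpace.{u}} : inl P Q P.pt = (wedge (pair P Q)).pt :=
  wedgeIncl_pt (V := pair P Q) false

@[simp] lemma inr_pt {P Q : PtdSpace.{u}} : inr P Q Q.pt = (wedge (pair P Q)).pt :=
  wedgeIncl_pt (V := pair P Q) true

namespace FibrewiseRetract

variable {A B C : PtdSpace.{u}} (D : FibrewiseRetract A B C)

/-- The pinch map followed by the retraction and the quotient map. -/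
noncomputable def split (b : B) (h : ℝ) : wedge (pair (susp A) (susp C)) :=
  if h ≤ 1 / 2 then inl _ _ (A.loop (D.r b) (2 * h)) else inr _ _ (C.loop (D.p b) (2 * h - 1))

lemma continuous_split {T : Type*} [TopologicalSpace T] {f : T → B} (hf : Continuous f) {g : T → ℝ}
    (hg : Continuous g) : Continuous fun t => D.split (f t) (g t) := by
  refine Continuous.if_le ?_ ?_ hg continuous_const fun t ht => ?_
  · exact (inl _ _).continuous.comp (continuous_loop (D.r.continuous.comp hf) (by fun_prop))
  · exact (inr _ _).continuous.comp (continuous_loop (D.continuous_p.comp hf) (by fun_prop))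
  · rw [loop_of_ge (by linarith), loop_of_le (by linarith), inl_pt, inr_pt]

lemma split_of_ge {b : B} {h : ℝ} (hh : 1 ≤ h) : D.split b h = (wedge _).pt := by
  rw [split, if_neg (by linarith), loop_of_ge (by linarith), inr_pt]

lemma split_of_le {b : B} {h : ℝ} (hh : h ≤ 0) : D.split b h = (wedge _).pt := by
  rw [split, if_pos (by linarith), loop_of_le (by linarith), inl_pt]

lemma split_pt {h : ℝ} : D.split B.pt h = (wedge _).pt := by
  rw [split]
  split_ifs
  · rw [loop_of_eq D.r_pt, inl_pt]
  · rw [loop_of_eq D.p_pt, inr_pt]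

/-- The comparison map `ΣB → ΣA ∨ ΣC`. -/
noncomputable def splitMap : C(susp B, wedge (pair (susp A) (susp C))) :=
  B.isCollapse_suspMk.desc (fun q => D.split q.1 q.2)
    (D.continuous_split continuous_fst (by fun_prop)) <| by
    have key : ∀ q ∈ B.suspSet, D.split q.1 q.2 = (wedge _).pt := by
      rintro ⟨b, t⟩ (rfl | rfl | rfl)
      · exact D.split_of_le le_rfl
      · exact D.split_of_ge le_rfl
      · exact D.split_pt
    exact fun q hq q' hq' => (key q hq).trans (key q' hq').symm

/-- Valid for every real height, since both sides are the base point outside `[0, 1]`. This lets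
later homotopies let heights overshoot. -/
lemma splitMap_loop (b : B) (h : ℝ) : D.splitMap (B.loop b h) = D.split b h := by
  refine (IsCollapse.desc_apply _ _ _ _ _).trans ?_
  rcases le_total h 0 with h0 | h0
  · rw [D.split_of_le h0, projIcc_of_le_left _ h0]
    exact D.split_of_le le_rfl
  rcases le_total 1 h with h1 | h1
  · rw [D.split_of_ge h1, projIcc_of_right_le _ h1]
    exact D.split_of_ge le_rfl
  · rw [projIcc_of_mem _ ⟨h0, h1⟩]

/-- The difference of the identity loop and the loop in `A`, truncated near `A`. -/
noncomputable def diff (b : B) (t : ℝ) : susp B :=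
  -- Down from height `1` to `1 - w` along the loop at `i (r b)`, then back up along the loop at `H
  -- (b, 1)`. For `w = 1` this is the full difference of loops; for `w < 1` the two loops coincide;
  -- for `w = 0` the path is constant, so it descends to `ΣC`.
  if t ≤ 1 / 2 then B.loop (D.i (D.r b)) (1 - 2 * t * D.w b)
  else B.loop (D.H (b, 1)) (1 - (2 - 2 * t) * D.w b)

/-- The halves meet at height `1 - w`: the base point if `w = 1`, and otherwise on one and the same
loop by `H_one`. -/
lemma continuous_diff : Continuous fun q : B × I => D.diff q.1 q.2 := by
  refine Continuous.if_le ?_ ?_ (by fun_prop) continuous_const fun q hq => ?_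
  · exact continuous_loop (by fun_prop) (by fun_prop)
  · exact continuous_loop (by fun_prop) (by fun_prop)
  · rw [hq]
    by_cases hw : D.w q.1 = 1
    · rw [hw, loop_of_le (by norm_num), loop_of_le (by norm_num)]
    · rw [D.H_one _ hw]
      norm_num

/-- The map `ΣC → ΣB` defined by `diff`. -/
noncomputable def diffMap : C(susp C, susp B) :=
  D.isCollapse_cyl.desc (fun q => D.diff q.1 q.2) D.continuous_diff <| by
    have key : ∀ q : B × I, (q.2 = 0 ∨ q.2 = 1 ∨ q.1 ∈ range D.i) →
        D.diff q.1 q.2 = (susp B).pt := by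
      rintro ⟨b, t⟩ (rfl | rfl | ⟨a, rfl⟩)
      · rw [diff, if_pos (by norm_num), loop_of_ge (by norm_num)]
      · rw [diff, if_neg (by norm_num), loop_of_ge (by norm_num)]
      · rw [diff, D.w_i, loop_of_ge (by norm_num), loop_of_ge (by norm_num), ite_self]
    exact fun q hq q' hq' => (key q hq).trans (key q' hq').symm

lemma diffMap_cyl (b : B) (t : I) : D.diffMap (D.cyl (b, t)) = D.diff b t :=
  IsCollapse.desc_apply _ _ _ _ _

lemma cyl_pt : D.cyl (B.pt, 0) = (susp C).pt := suspMk_eq_pt_iff.2 (Or.inl rfl)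

lemma diffMap_pt : D.diffMap (susp C).pt = (susp B).pt := by
  rw [← D.cyl_pt, diffMap_cyl, diff, if_pos (by norm_num), loop_of_ge (by norm_num)]

end FibrewiseRetract

/-- The suspension of a based map. -/
lemma exists_suspMap {X Y : PtdSpace.{u}} (f : C(X, Y)) (hf : f X.pt = Y.pt) :
    ∃ g : C(susp X, susp Y), ∀ x h, g (X.loop x h) = Y.loop (f x) h := by
  refine ⟨X.isCollapse_suspMk.desc (fun q => Y.suspMk (f q.1, q.2)) (by fun_prop) ?_,
    fun x h => IsCollapse.desc_apply _ _ _ _ _⟩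
  have key : ∀ q ∈ X.suspSet, Y.suspMk (f q.1, q.2) = (susp Y).pt := by
    rintro ⟨x, t⟩ (h | h | h)
    exacts [suspMk_eq_pt_iff.2 (Or.inl h), suspMk_eq_pt_iff.2 (Or.inr (Or.inl h)),
      suspMk_eq_pt_iff.2 (Or.inr (Or.inr (by rw [show x = X.pt from h, hf])))]
  exact fun q hq q' hq' => (key q hq).trans (key q' hq').symm

lemma loop_pt {X : PtdSpace.{u}} : X.loop X.pt 0 = (susp X).pt := loop_of_le le_rfl

/-- Homotopies between maps out of a suspension. -/
lemma homotopicRel_susp {X : PtdSpace.{u}} {Y : Type*} [TopologicalSpace Y] {f g : C(susp X, Y)}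
    (y : Y) (F : (X × I) × I → Y) (hF : Continuous F)
    (h0 : ∀ x t, F ((x, t), 0) = f (X.loop x t)) (h1 : ∀ x t, F ((x, t), 1) = g (X.loop x t))
    (hl : ∀ x s, F ((x, 0), s) = y) (hr : ∀ x s, F ((x, 1), s) = y)
    (hpt : ∀ t s, F ((X.pt, t), s) = y) : f.HomotopicRel g {(susp X).pt} := by
  have hy : f (X.suspMk (X.pt, 0)) = y := by
    have := h0 X.pt 0
    rw [loop_coe] at this
    rw [← this, hl]
  refine X.isCollapse_suspMk.homotopicRel (n := (X.pt, 0)) (Or.inl rfl) F hF ?_ ?_ ?_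
  · rintro ⟨x, t⟩
    rw [h0, loop_coe]
  · rintro ⟨x, t⟩
    rw [h1, loop_coe]
  · rintro ⟨x, t⟩ (h | h | h) s
    · rw [hy]
      obtain rfl : t = 0 := h
      exact hl x s
    · rw [hy]
      obtain rfl : t = 1 := h
      exact hr x s
    · rw [hy]
      obtain rfl : x = X.pt := h
      exact hpt t s

namespace FibrewiseRetract

variable {A B C : PtdSpace.{u}} (D : FibrewiseRetract A B C)

/-- The homotopy inverse of `splitMap`, corresponding to `i r + (1 - i r) = 1` for loops. -/
lemma exists_unsplitMap : ∃ g : C(wedge (pair (susp A) (susp C)), susp B),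
    (∀ a h, g (inl _ _ (A.loop a h)) = B.loop (D.i a) h) ∧
    ∀ x, g (inr _ _ x) = D.diffMap x := by
  obtain ⟨j, hj⟩ := exists_suspMap D.i D.i_pt
  obtain ⟨g, hg⟩ := exists_wedge_desc (V := pair (susp A) (susp C)) (susp B).pt
    (fun k => Bool.rec (motive := fun k => C(pair (susp A) (susp C) k, susp B)) j D.diffMap k) (by
      rintro (_ | _)
      · change j (susp A).pt = _
        rw [← loop_pt, hj]
        exact loop_of_le le_rfl
      · exact D.diffMap_pt)
  refine ⟨g, fun a h => ?_, fun x => hg true x⟩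
  rw [← hj]
  exact hg false _

lemma unsplit_loop {g : C(wedge (pair (susp A) (susp C)), susp B)}
    (hg : ∀ x, g (inr _ _ x) = D.diffMap x) (b : B) (t : I) :
    g (inr _ _ (C.loop (D.p b) t)) = D.diff b t := by
  rw [hg, loop_coe, ← D.diffMap_cyl]
  rfl

/-- The composite climbs the loop at `i (r b)` to the top, descends to `1 - w` and climbs on along
`H (b, 1)`. Cancelling the backtracking gives `m`; undoing the deformation `H` then gives the
identity. -/
lemma unsplit_split {g : C(wedge (pair (susp A) (susp C)), susp B)}
    (hgA : ∀ a h, g (inl _ _ (A.loop a h)) = B.loop (D.i a) h)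
    (hgC : ∀ x, g (inr _ _ x) = D.diffMap x) :
    (g.comp D.splitMap).HomotopicRel (.id _) {(susp B).pt} := by
  -- Height profile without backtracking: linear from `0` to `1 - w` up to time `3/4`, then linear
  -- to `1`. The break is where `diff`, run on `[1/2, 1]`, changes loops.
  let τ : I → I → ℝ := fun t w => (1 - w) * min (4 * t / 3 : ℝ) 1 + w * max 0 (4 * t - 3 : ℝ)
  have hτ0 : ∀ w, τ 0 w = 0 := fun w => by simp [τ]
  have hτ1 : ∀ w, τ 1 w = 1 := fun w => by norm_num [τ]
  have hτle : ∀ t w : I, (t : ℝ) ≤ 3 / 4 → τ t w = 4 * t / 3 * (1 - w) := fun t w h => by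
    simp only [τ]
    rw [min_eq_left (by linarith), max_eq_left (by linarith)]
    ring
  have hτge : ∀ t w : I, 3 / 4 ≤ (t : ℝ) → τ t w = 1 - (4 - 4 * t) * w := fun t w h => by
    simp only [τ]
    rw [min_eq_right (by linarith), max_eq_right (by linarith)]
    ring
  have hτc : Continuous fun q : B × I => τ q.2 (D.w q.1) := by fun_prop
  let m : C(susp B, susp B) := B.isCollapse_suspMk.desc
    (fun q => B.loop (D.H (q.1, 1)) (τ q.2 (D.w q.1))) (continuous_loop (by fun_prop) hτc) <| by
    have key : ∀ q ∈ B.suspSet, B.loop (D.H (q.1, 1)) (τ q.2 (D.w q.1)) = (susp B).pt := by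
      rintro ⟨b, t⟩ (rfl | rfl | rfl)
      · exact loop_of_le (hτ0 _).le
      · exact loop_of_ge (hτ1 _).ge
      · exact loop_of_eq (D.H_pt _)
    exact fun q hq q' hq' => (key q hq).trans (key q' hq').symm
  have hm : ∀ b (t : I), m (B.loop b t) = B.loop (D.H (b, 1)) (τ t (D.w b)) := fun b t => by
    rw [loop_coe]
    exact IsCollapse.desc_apply _ _ _ _ _
  refine ContinuousMap.HomotopicRel.trans (g := m) ?_ ?_
  -- The original profile up to time `3/4`: up to `1`, then down to `1 - w`. It is interpolated
  -- linearly to `τ` with endpoints fixed.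
  · let α : I → I → ℝ := fun t w => min (2 * t : ℝ) 1 - max 0 (4 * t - 2 : ℝ) * w
    have hα : Continuous fun q : B × I => α q.2 (D.w q.1) := by fun_prop
    refine homotopicRel_susp (susp B).pt (fun q => if (q.1.2 : ℝ) ≤ 3 / 4 then
      B.loop (D.i (D.r q.1.1)) ((1 - q.2) * α q.1.2 (D.w q.1.1) +
        q.2 * (4 * q.1.2 / 3 * (1 - D.w q.1.1)))
      else B.loop (D.H (q.1.1, 1)) (1 - (4 - 4 * q.1.2) * D.w q.1.1)) ?_ ?_ ?_ ?_ ?_ ?_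
    · refine Continuous.if_le ?_ ?_ (by fun_prop) continuous_const fun q hq => ?_
      · exact continuous_loop (by fun_prop) (by fun_prop)
      · exact continuous_loop (by fun_prop) (by fun_prop)
      · have : α q.1.2 (D.w q.1.1) = 1 - D.w q.1.1 := by
          simp only [α, hq]; norm_num
        rw [this, hq]
        by_cases hw : D.w q.1.1 = 1
        · rw [hw, loop_of_le (by norm_num), loop_of_le (by norm_num)]
        · rw [D.H_one _ hw]
          congr 1
          ring
    · intro b t
      rw [ContinuousMap.comp_apply, splitMap_loop, split]
      dsimp only
      rcases le_or_gt (t : ℝ) (1 / 2) with ht | ht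
      · rw [if_pos (by linarith), if_pos ht, hgA]
        congr 1
        simp only [α]
        rw [min_eq_left (by linarith), max_eq_left (by linarith)]
        simp
      · rw [if_neg (not_le.2 ht)]
        have h2 := D.unsplit_loop hgC b ⟨2 * t - 1, by linarith, by linarith [t.2.2]⟩
        simp only at h2
        rw [h2, diff]
        rcases le_or_gt (t : ℝ) (3 / 4) with ht' | ht'
        · rw [if_pos ht', if_pos (by linarith)]
          congr 1
          simp only [α]
          rw [min_eq_right (by linarith), max_eq_right (by linarith), Icc.coe_zero]
          ring
        · rw [if_neg (not_le.2 ht'), if_neg (by linarith)]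
          congr 1
          ring
    · intro b t
      rw [hm]
      dsimp only
      rcases le_or_gt (t : ℝ) (3 / 4) with ht' | ht'
      · rw [if_pos ht', hτle _ _ ht', Icc.coe_one, sub_self, zero_mul, zero_add, one_mul]
        by_cases hw : D.w b = 1
        · rw [hw, loop_of_le (by norm_num), loop_of_le (by norm_num)]
        · rw [D.H_one _ hw]
      · rw [if_neg (not_le.2 ht'), hτge _ _ ht'.le]
    · intro b s
      dsimp only
      rw [if_pos (by norm_num), loop_of_le]
      simp [α]
    · intro b s
      dsimp only
      rw [if_neg (by norm_num), loop_of_ge (by norm_num)]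
    · intro t s
      dsimp only
      rw [D.r_pt, D.i_pt, D.H_pt, loop_of_eq rfl, loop_of_eq rfl, ite_self]
  -- Run `H` backwards while straightening the height from `τ` to `t`.
  · refine homotopicRel_susp (susp B).pt (fun q => B.loop (D.H (q.1.1, σ q.2))
      ((1 - q.2) * τ q.1.2 (D.w q.1.1) + q.2 * q.1.2)) ?_ ?_ ?_ ?_ ?_ ?_
    · exact continuous_loop (by fun_prop) (by fun_prop)
    · intro b t
      simp [hm]
    · intro b t
      simp [D.H_zero]
    · intro b s
      exact loop_of_le (by simp [hτ0])
    · intro b s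
      exact loop_of_ge (by simp [hτ1])
    · intro t s
      exact loop_of_eq (D.H_pt _)

/-- On `A` the retraction is the identity and the `C` half is constant, so only the doubled speed
has to be undone. -/
lemma split_unsplit_left {g : C(wedge (pair (susp A) (susp C)), susp B)}
    (hgA : ∀ a h, g (inl _ _ (A.loop a h)) = B.loop (D.i a) h) :
    ((D.splitMap.comp g).comp (inl _ _)).HomotopicRel (inl (susp A) (susp C)) {(susp A).pt} := by
  refine homotopicRel_susp (wedge (pair (susp A) (susp C))).pt
    (fun q => inl _ _ (A.loop q.1.1 ((2 - q.2) * q.1.2))) ?_ ?_ ?_ ?_ ?_ ?_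
  · exact (inl _ _).continuous.comp (continuous_loop (by fun_prop) (by fun_prop))
  · intro a t
    simp only [ContinuousMap.comp_apply]
    rw [hgA, splitMap_loop, split, D.r_i, D.p_i]
    split_ifs with h
    · simp
    · rw [loop_of_ge, inl_pt, loop_of_eq rfl, inr_pt]
      push Not at h
      simp
      linarith
  · intro a t
    norm_num
  · intro a s
    rw [loop_of_le (by simp), inl_pt]
  · intro a s
    rw [loop_of_ge, inl_pt]
    have := s.2.2
    simp
    linarith
  · intro t s
    rw [loop_of_eq rfl, inl_pt]

end FibrewiseRetract

namespace FibrewiseRetract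

variable {A B C : PtdSpace.{u}} (D : FibrewiseRetract A B C)

lemma homotopicRel_cyl {Y : Type*} [TopologicalSpace Y] {f g : C(susp C, Y)}
    (y : Y) (F : (B × I) × I → Y) (hF : Continuous F)
    (h0 : ∀ b t, F ((b, t), 0) = f (D.cyl (b, t))) (h1 : ∀ b t, F ((b, t), 1) = g (D.cyl (b, t)))
    (hl : ∀ b s, F ((b, 0), s) = y) (hr : ∀ b s, F ((b, 1), s) = y)
    (hi : ∀ a t s, F ((D.i a, t), s) = y) : f.HomotopicRel g {(susp C).pt} := by
  have hy : f (D.cyl (B.pt, 0)) = y := by rw [← h0 B.pt 0, hl]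
  rw [← D.cyl_pt]
  refine D.isCollapse_cyl.homotopicRel (n := (B.pt, 0)) (Or.inl rfl) F hF (fun q => h0 _ _)
    (fun q => h1 _ _) ?_
  rintro ⟨b, t⟩ (h | h | ⟨a, h⟩) s
  · rw [hy]
    obtain rfl : t = 0 := h
    exact hl b s
  · rw [hy]
    obtain rfl : t = 1 := h
    exact hr b s
  · rw [hy]
    obtain rfl : D.i a = b := h
    exact hi a t s

/-- The composite descends and re-ascends the same loop in `ΣA` around a path in `ΣC`. The `ΣA` part
is pushed off over the top, and the rest is deformed to the identity by undoing `H`. -/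
lemma split_unsplit_right {g : C(wedge (pair (susp A) (susp C)), susp B)}
    (hgC : ∀ x, g (inr _ _ x) = D.diffMap x) :
    ((D.splitMap.comp g).comp (inr _ _)).HomotopicRel (inr (susp A) (susp C)) {(susp C).pt} := by
  -- On the second half this is the `ΣC` height `2ν - 1`. On the first half it only joins `0` to `1
  -- - 2w`: there the loop is at the base point, since either `w = 1` and the height is not
  -- positive, or `H (b, 1)` lies in `A`.
  let η : I → I → ℝ := fun t w => min (2 * t : ℝ) 1 * (1 - 2 * w) + w * max 0 (4 * t - 2 : ℝ)
  have hη0 : ∀ w, η 0 w = 0 := fun w => by simp [η]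
  have hη1 : ∀ w, η 1 w = 1 := fun w => by norm_num [η]; ring
  have hηc : Continuous fun q : B × I => η q.2 (D.w q.1) := by fun_prop
  have hηle : ∀ t w : I, (t : ℝ) ≤ 1 / 2 → η t w = 2 * t * (1 - 2 * w) := fun t w h => by
    simp only [η]
    rw [min_eq_left (by linarith), max_eq_left (by linarith)]
    ring
  have hηge : ∀ t w : I, 1 / 2 ≤ (t : ℝ) → η t w = 1 - (4 - 4 * t) * w := fun t w h => by
    simp only [η]
    rw [min_eq_right (by linarith), max_eq_right (by linarith)]
    ring
  let m : C(susp C, wedge (pair (susp A) (susp C))) := D.isCollapse_cyl.desc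
    (fun q => inr _ _ (C.loop (D.p (D.H (q.1, 1))) (η q.2 (D.w q.1))))
    ((inr _ _).continuous.comp
      (continuous_loop (D.continuous_p.comp (by fun_prop)) hηc)) <| by
    have key : ∀ q : B × I, (q.2 = 0 ∨ q.2 = 1 ∨ q.1 ∈ range D.i) →
        inr (susp A) _ (C.loop (D.p (D.H (q.1, 1))) (η q.2 (D.w q.1))) = (wedge _).pt := by
      rintro ⟨b, t⟩ (rfl | rfl | ⟨a, rfl⟩)
      · rw [loop_of_le (hη0 _).le, inr_pt]
      · rw [loop_of_ge (hη1 _).ge, inr_pt]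
      · rw [D.H_i, loop_of_eq (D.p_i a), inr_pt]
    exact fun q hq q' hq' => (key q hq).trans (key q' hq').symm
  have hm : ∀ b (t : I), m (D.cyl (b, t)) =
      inr _ _ (C.loop (D.p (D.H (b, 1))) (η t (D.w b))) := fun b t =>
    IsCollapse.desc_apply _ _ _ _ _
  refine ContinuousMap.HomotopicRel.trans (g := m) ?_ ?_
  -- `ν` is the height of `diff`. Since `r` is unchanged by `H`, both halves follow the same loop in
  -- `ΣA`.
  · let ν : I → I → ℝ := fun t w => 1 - 2 * w * min (t : ℝ) (1 - t)
    have hνc : Continuous fun q : B × I => ν q.2 (D.w q.1) := by fun_prop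
    have hνle : ∀ t w : I, (t : ℝ) ≤ 1 / 2 → ν t w = 1 - 2 * t * w := fun t w h => by
      simp only [ν]
      rw [min_eq_left (by linarith)]
      ring
    have hνge : ∀ t w : I, 1 / 2 ≤ (t : ℝ) → ν t w = 1 - (2 - 2 * t) * w := fun t w h => by
      simp only [ν]
      rw [min_eq_right (by linarith)]
      ring
    refine D.homotopicRel_cyl (wedge (pair (susp A) (susp C))).pt
      -- The `ΣA` branch covers the first half and, later, heights up to `1/2`. Adding `2s` lifts it
      -- past the top, as `ν ≥ 0`, and keeps it at the base point where the branches meet.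
      (fun q => if min (q.1.2 : ℝ) (ν q.1.2 (D.w q.1.1)) ≤ 1 / 2 then
        inl _ _ (A.loop (D.r q.1.1) (2 * ν q.1.2 (D.w q.1.1) + 2 * q.2))
        else inr _ _ (C.loop (D.p (D.H (q.1.1, 1))) (2 * ν q.1.2 (D.w q.1.1) - 1)))
      ?_ ?_ ?_ ?_ ?_ ?_
    · refine Continuous.if_le ?_ ?_ (by fun_prop) continuous_const fun q hq => ?_
      · exact (inl _ _).continuous.comp (continuous_loop (by fun_prop) (by fun_prop))
      · exact (inr _ _).continuous.comp
          (continuous_loop (D.continuous_p.comp (by fun_prop)) (by fun_prop))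
      · have hs := q.2.2.1
        have hle : 1 / 2 ≤ ν q.1.2 (D.w q.1.1) := hq ▸ min_le_right _ _
        rw [loop_of_ge (by linarith), inl_pt]
        rcases min_choice (q.1.2 : ℝ) (ν q.1.2 (D.w q.1.1)) with h | h
        · rw [h] at hq
          by_cases hw : D.w q.1.1 = 1
          · rw [loop_of_le, inr_pt]
            rw [hνle _ _ hq.le, hw, hq]
            norm_num
          · rw [D.H_one _ hw, loop_of_eq (D.p_i _), inr_pt]
        · rw [h] at hq
          rw [hq, loop_of_le (by norm_num), inr_pt]
    · intro b t
      simp only [ContinuousMap.comp_apply]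
      rw [hgC, diffMap_cyl, diff]
      rcases le_or_gt (t : ℝ) (1 / 2) with ht | ht
      · rw [if_pos ht, if_pos ((min_le_left _ _).trans ht), splitMap_loop, split, D.r_i, D.p_i,
          hνle _ _ ht, Icc.coe_zero, mul_zero, add_zero]
        split_ifs with h
        · rfl
        · rw [loop_of_ge (by linarith), loop_of_eq rfl, inl_pt, inr_pt]
      · rw [if_neg (not_le.2 ht), splitMap_loop, split, D.r_H, hνge _ _ ht.le, Icc.coe_zero,
          mul_zero, add_zero]
        refine if_congr ?_ rfl rfl
        rw [min_le_iff, or_iff_right (not_le.2 ht)]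
    · intro b t
      rw [hm]
      dsimp only
      rcases le_or_gt (t : ℝ) (1 / 2) with ht | ht
      · rw [if_pos ((min_le_left _ _).trans ht), loop_of_ge, inl_pt]
        · by_cases hw : D.w b = 1
          · rw [loop_of_le, inr_pt]
            rw [hηle _ _ ht, hw]
            have := t.2.1
            norm_num
            exact this
          · rw [D.H_one _ hw, loop_of_eq (D.p_i _), inr_pt]
        · have h1 : 2 * (t : ℝ) * D.w b ≤ 1 :=
            mul_le_one₀ (by linarith) (D.w b).2.1 (D.w b).2.2
          rw [hνle _ _ ht, Icc.coe_one]
          linarith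
      · rw [hνge _ _ ht.le, hηge _ _ ht.le]
        split_ifs with h
        · have h := (min_le_iff.1 h).resolve_left (not_le.2 ht)
          have hw : (2 - 2 * (t : ℝ)) * D.w b ≤ 1 :=
            mul_le_one₀ (by linarith) (D.w b).2.1 (D.w b).2.2
          rw [loop_of_ge (by rw [Icc.coe_one]; linarith), loop_of_le (by linarith), inl_pt, inr_pt]
        · congr 2
          ring
    · intro b s
      have hs := s.2.1
      dsimp only
      rw [if_pos (by simp), loop_of_ge, inl_pt]
      simp only [ν, Icc.coe_zero]
      norm_num
      linarith
    · intro b s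
      dsimp only
      rw [if_neg, loop_of_ge, inr_pt]
      · simp only [ν, Icc.coe_one]; norm_num
      · simp only [ν, Icc.coe_one]; norm_num
    · intro a t s
      have hs := s.2.1
      dsimp only
      rw [D.w_i]
      simp only [ν, Icc.coe_zero]
      rw [loop_of_ge (by linarith), loop_of_ge (by linarith), inl_pt, inr_pt, ite_self]
  · refine D.homotopicRel_cyl (wedge (pair (susp A) (susp C))).pt
      (fun q => inr _ _ (C.loop (D.p (D.H (q.1.1, σ q.2)))
        ((1 - q.2) * η q.1.2 (D.w q.1.1) + q.2 * q.1.2))) ?_ ?_ ?_ ?_ ?_ ?_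
    · exact (inr _ _).continuous.comp
        (continuous_loop (D.continuous_p.comp (by fun_prop)) (by fun_prop))
    · intro b t
      simp [hm]
    · intro b t
      simp only [unitInterval.symm_one, D.H_zero, Icc.coe_one, sub_self, zero_mul, zero_add,
        one_mul, loop_coe]
      rfl
    · intro b s
      rw [loop_of_le (by simp [hη0]), inr_pt]
    · intro b s
      rw [loop_of_ge (by simp [hη1]), inr_pt]
    · intro a t s
      rw [D.H_i, loop_of_eq (D.p_i a), inr_pt]

/-- The suspension of `B` splits as the wedge of the suspensions of `A` and of `B / A`. -/
theorem htpyEquiv (D : FibrewiseRetract A B C) :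
    HtpyEquiv (susp B) (wedge (pair (susp A) (susp C))) := by
  obtain ⟨g, hgA, hgC⟩ := D.exists_unsplitMap
  refine ⟨D.splitMap, g, ?_, ?_, D.unsplit_split hgA hgC, homotopicRel_wedge ?_⟩
  · rw [← loop_pt, splitMap_loop]
    exact D.split_of_le le_rfl
  · rw [← inl_pt, ← loop_pt, hgA, loop_of_le le_rfl]
  · rintro (_ | _)
    · exact D.split_unsplit_left hgA
    · exact D.split_unsplit_right hgC

end FibrewiseRetract

/-! ### Products and the conclusion -/

/-- The product as a space over the product of the last factors. -/
noncomputable def prodFibrewiseRetract {k : ℕ} (X : Fin (k + 1) → PtdSpace.{u}) (w : C(X 0, I))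
    (H : C(X 0 × I, X 0)) (hw : w (X 0).pt = 0) (H0 : ∀ x, H (x, 0) = x)
    (Hpt : ∀ t, H ((X 0).pt, t) = (X 0).pt) (H1 : ∀ x, w x ≠ 1 → H (x, 1) = (X 0).pt) :
    FibrewiseRetract (prod fun i : Fin k => X i.succ) (prod X) (smashOn X {0}) where
  i := (⟨CompactCoherentification.map fun z =>
      (Homeomorph.piFinSucc fun i => (X i : Type u)).symm ((X 0).pt, z),
    CompactCoherentification.continuous_map_of_continuous
      ((Homeomorph.piFinSucc fun i => (X i : Type u)).symm.continuous.comp (by fun_prop))⟩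
    : C(𝐤 (∀ i : Fin k, X i.succ), 𝐤 (∀ i, X i)))
  r := (⟨CompactCoherentification.map fun p i => p i.succ,
    CompactCoherentification.continuous_map_of_continuous (by fun_prop)⟩
    : C(𝐤 (∀ i, X i), 𝐤 (∀ i : Fin k, X i.succ)))
  p := collapseMk _ _
  w := (⟨fun p => w ((CompactCoherentification.mk _).symm p 0), w.continuous.comp
    ((continuous_apply 0).comp CompactCoherentification.continuous_mk_symm)⟩ : C(𝐤 (∀ i, X i), I))
  H := (⟨fun q => CompactCoherentification.mk _ <|
      (Homeomorph.piFinSucc fun i => (X i : Type u)).symm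
        (H ((CompactCoherentification.mk _).symm q.1 0, q.2),
          fun i => (CompactCoherentification.mk _).symm q.1 i.succ), by
    have h1 : Continuous fun q : 𝐤 (∀ i, X i) × I => (CompactCoherentification.mk _).symm q.1 :=
      CompactCoherentification.continuous_mk_symm.comp continuous_fst
    refine CompactCoherentification.continuous_mk_comp
      ((Homeomorph.piFinSucc fun i => (X i : Type u)).symm.continuous.comp ?_)
    exact (H.continuous.comp ((((continuous_apply 0).comp h1)).prodMk continuous_snd)).prodMk
      (continuous_pi fun i => (continuous_apply i.succ).comp h1)⟩ : C(𝐤 (∀ i, X i) × I, 𝐤 (∀ i, X i)))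
  i_pt := by
    refine congrArg (CompactCoherentification.mk _) (funext fun i => ?_)
    refine Fin.cases ?_ (fun i => ?_) i <;> rfl
  r_i _ := rfl
  isCollapse := by
    have h := isCollapse_collapseMk {p : 𝐤 (∀ i, X i) | ∃ j ∈ ({0} : Set (Fin (k + 1))),
      (CompactCoherentification.mk (∀ i, X i)).symm p j = (X j).pt}
      (CompactCoherentification.mk _ fun i => (X i).pt)
    refine (congrArg (IsCollapse _) (Set.ext fun p => ?_)).mpr h
    constructor
    · rintro ⟨z, rfl⟩
      exact ⟨0, rfl, rfl⟩
    · rintro ⟨j, hj, h⟩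
      obtain rfl : j = 0 := hj
      refine ⟨CompactCoherentification.mk _ fun i => (CompactCoherentification.mk _).symm p i.succ,
        (CompactCoherentification.mk _).symm.injective (funext fun i => ?_)⟩
      refine Fin.cases h.symm (fun i => ?_) i
      rfl
  p_pt := rfl
  w_i _ := hw
  H_zero p := by
    refine (CompactCoherentification.mk _).symm.injective (funext fun i => ?_)
    refine Fin.cases (H0 _) (fun i => ?_) i
    rfl
  H_i z t := by
    refine (CompactCoherentification.mk _).symm.injective (funext fun i => ?_)
    refine Fin.cases (Hpt t) (fun i => ?_) i
    rfl
  r_H _ _ := rfl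
  H_one p hp := by
    refine (CompactCoherentification.mk _).symm.injective (funext fun i => ?_)
    refine Fin.cases (H1 _ hp) (fun i => ?_) i
    rfl

/-- The points with coordinate `0` at the base point form a section of the projection forgetting
that coordinate. A contraction near the base point of `X 0` deforms a neighbourhood onto this
section fibrewise. -/
theorem susp_prod {k : ℕ} {X : Fin (k + 1) → PtdSpace.{u}} (h : (X 0).IsCW) :
    HtpyEquiv (susp (prod X))
      (wedge (pair (susp (prod fun i : Fin k => X i.succ)) (susp (smashOn X {0})))) := by
  obtain ⟨w, H, hw, H0, Hpt, H1⟩ := h.wellPointed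
  exact (prodFibrewiseRetract X w H hw H0 Hpt H1).htpyEquiv

lemma subsingleton_susp_iterate (X : PtdSpace.{u}) [h : Subsingleton X] (n : ℕ) :
    Subsingleton (susp^[n] X) := by
  induction n with
  | zero => exact h
  | succ n ih =>
    rw [iterate_succ_apply']
    refine subsingleton_of_forall_eq (susp (susp^[n] X)).pt fun y => ?_
    obtain ⟨p, rfl⟩ := (isCollapse_suspMk _).isQuotientMap.surjective y
    exact suspMk_eq_pt_iff.2 (Or.inr (Or.inr (Subsingleton.elim _ _)))

lemma HtpyEquiv.of_subsingleton {X Y : PtdSpace.{u}} [Subsingleton X] [Subsingleton Y] :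
    HtpyEquiv X Y :=
  .of_homeomorph
    ⟨⟨fun _ => Y.pt, fun _ => X.pt, fun _ => Subsingleton.elim _ _, fun _ => Subsingleton.elim _ _⟩,
      continuous_const, continuous_const⟩ rfl

/-- A homotopy equivalence after suspensions transfers the property of being an `SⁿS`-space. -/
lemma IsSnS.of_htpyEquiv {n : ℕ} {X Y : PtdSpace.{u}} (hY : IsSnS n Y) (hX : X.IsCW)
    (h : HtpyEquiv (susp^[n] X) (susp^[n] Y)) : IsSnS n X := by
  obtain ⟨-, Z, hZ, hYZ⟩ := hY
  exact ⟨hX, Z, hZ, h.trans hYZ⟩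

/-- Induction on the number of factors. The splitting has as summands a shorter product and a
half-smash, which needs only `X 0` to be an `SⁿS`-space. -/
theorem isSnS_prod {n : ℕ} (hn : 1 ≤ n) {k : ℕ} {X : Fin k → PtdSpace.{u}}
    (h : ∀ i, IsSnS n (X i)) : IsSnS n (prod X) := by
  induction k with
  | zero =>
    have hX : (prod X).IsCW := .prod fun i => (h i).1
    have : Subsingleton (prod X) := inferInstanceAs (Subsingleton (∀ i : Fin 0, X i))
    have := subsingleton_susp_iterate (prod X) n
    have := subsingleton_susp_iterate (prod X) (n + 1)
    -- The empty product is a point, and so are all its suspensions.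
    exact ⟨hX, prod X, hX, .of_subsingleton⟩
  | succ k ih =>
    have hA : IsSnS n (prod fun i : Fin k => X i.succ) := ih fun i => h i.succ
    have hC : IsSnS n (smashOn X {0}) := .smashOn (fun i => (h i).1) (h 0) rfl
    have hW : IsSnS n (wedge (pair (prod fun i : Fin k => X i.succ) (smashOn X {0}))) := by
      refine .wedge ?_
      rintro (_ | _)
      exacts [hA, hC]
    refine hW.of_htpyEquiv (.prod fun i => (h i).1) ?_
    -- The innermost suspension is spent on the splitting; the other `m` are applied to the
    -- resulting equivalence.
    obtain ⟨m, rfl⟩ := Nat.exists_eq_add_of_le' hn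
    rw [iterate_succ_apply, iterate_succ_apply]
    refine HtpyEquiv.susp_iterate ((susp_prod (h 0).1).trans (.trans ?_ (susp_wedge _).symm)) m
    refine .wedge ?_
    rintro (_ | _)
    exacts [.refl _, .refl _]

end PtdSpace

end

theorem mainTheorem10 (n k : ℕ) [NeZero k] (X : Fin k → PtdSpace.{u})
    (hX : ∀ i, PtdSpace.IsSnS n (X i)) :
    PtdSpace.IsSnS n (PtdSpace.wedge X) ∧
    PtdSpace.IsSnS n (PtdSpace.smash X) ∧
    (1 ≤ n → PtdSpace.IsSnS n (PtdSpace.prod X)) := by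
  obtain ⟨k, rfl⟩ := Nat.exists_eq_succ_of_ne_zero (NeZero.ne k)
  refine ⟨.wedge hX, ?_, fun hn => PtdSpace.isSnS_prod hn hX⟩
  rw [PtdSpace.smash_eq_smashOn]
  exact .smashOn (fun i => (hX i).1) (hX 0) (Set.mem_univ 0)
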